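/- Let $\mathbb{H}=\{x+iy : y>0\}$ be the hyperbolic plane with the metric $g=(dx^2+dy^2)/y^2$, the orientation and complex structure induced from $\mathbb{C}$, and the area form $\omega = dx\wedge dy/y^2$. Let $\exp\colon T\mathbb{H}\to\mathbb{H}$ be its exponential map. For real $\theta,\varphi$ define $R_\theta\colon T\mathbb{H}\to T\mathbb{H}$ and $F_\varphi\colon T\mathbb{H}\to\mathbb{H}\times\mathbb{H}$ by $$R_\theta(x,v)=(x,e^{i\theta}v),\qquad F_\varphi(x,v)=\big(\exp(x,v),\exp(x,e^{i\varphi}v)\big).$$ Let $\pi_1,\pi_2\colon\mathbb{H}\times\mathbb{H}\to\mathbb{H}$ be the projections, $\omega_k=\pi_k^*\omega$ for $k=1,2$, and $\omega_a=a\,\omega_1+\omega_2$ for $a\in\mathbb{R}$. **Proposition.** Let $\theta,\varphi_1,\varphi_2$ be real numbers with $0<\theta<\varphi_1\le\pi$ and $\varphi_1<\varphi_2+\theta<2\pi$, and put $$a=\frac{\sin\left(\frac{\varphi_2+\theta}{2}\right)\sin\left(\frac{\varphi_2+\theta-\varphi_1}{2}\right)}{\sin\left(\frac{\theta}{2}\right)\sin\left(\frac{\varphi_1-\theta}{2}\right)}.$$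 Then $F_{\varphi_1}$ is a bijection, the map $I=I^\theta_{(\varphi_1,\varphi_2)}=F_{\varphi_2}\circ R_\theta\circ F_{\varphi_1}^{-1}\colon\mathbb{H}\times\mathbb{H}\to\mathbb{H}\times\mathbb{H}$ is smooth, $a\neq 0$, $\omega_a$ is a symplectic form on $\mathbb{H}\times\mathbb{H}$, and there are non-zero real numbers $b,c$ (depending only on $\theta,\varphi_1,\varphi_2$) such that $$I^*\omega_a=b\,\omega_1+c\,\omega_2 .$$ Moreover, for every smooth Jordan curve $\gamma\subset\mathbb{H}$ (the image of a smooth embedding of the circle), both $\gamma\times\gamma$ and $I(\gamma\times\gamma)$ are Lagrangian tori in $(\mathbb{H}\times\mathbb{H},\omega_a)$, that is, smoothly embedded two-dimensional tori on which $\omega_a$ vanishes. -/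

import Mathlib

open UpperHalfPlane Manifold Topology
open scoped ContDiff

namespace HypProd

noncomputable section

/-! ## The hyperbolic plane as a Riemannian surface

The hyperbolic plane is Mathlib's upper half-plane `ℍ`, viewed as a real two-dimensional manifold
with model `𝓘(ℝ, ℂ)` (its single chart is the inclusion `ℍ → ℂ`), so that each tangent space
`TangentSpace 𝓘(ℝ, ℂ) x` is `ℂ`; the complex structure `j` is multiplication by `Complex.I`. -/

instance : IsManifold 𝓘(ℝ, ℂ) ∞ ℍ := isOpenEmbedding_coe.isManifold_singleton

/-- The hyperbolic metric `(dx² + dy²) / y²` at the point `z` (used for `0 < z.im`). -/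
def hypMetric (z u w : ℂ) : ℝ := (u.re * w.re + u.im * w.im) / z.im ^ 2

/-- Geodesics of the hyperbolic metric `g`, defined on all of `ℝ`. In coordinates, the equation
`∇_{γ'} γ' = 0` for the Levi-Civita connection of `g`, paired with an arbitrary constant vector
field `w`, is `d/dt g_γ(γ', w) = ½ (∂_w g)_γ(γ', γ')` (by the formula for the Christoffel symbols;
this is the Euler-Lagrange equation of the energy). -/
def IsGeodesic (γ : ℝ → ℍ) : Prop :=
  ContDiff ℝ ∞ (fun t => (γ t : ℂ)) ∧
  ∀ (t : ℝ) (w : ℂ),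
    deriv (fun s => hypMetric (γ s) (deriv (fun r => (γ r : ℂ)) s) w) t =
      1 / 2 * fderiv ℝ (fun ζ : ℂ => hypMetric ζ (deriv (fun r => (γ r : ℂ)) t)
        (deriv (fun r => (γ r : ℂ)) t)) (γ t : ℂ) w

/-- `γ` is a geodesic with `γ(0) = x` and `γ'(0) = v`. -/
def IsGeodesicFrom (x : ℍ) (v : ℂ) (γ : ℝ → ℍ) : Prop :=
  IsGeodesic γ ∧ γ 0 = x ∧ deriv (fun t => (γ t : ℂ)) 0 = v

theorem fderiv_hypMetric (p z w : ℂ) (hz : z.im ≠ 0) :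
    fderiv ℝ (fun ζ : ℂ => hypMetric ζ p p) z w =
      -2 * (p.re * p.re + p.im * p.im) * w.im / z.im ^ 3 := by
  have h1 : HasFDerivAt (fun ζ : ℂ => ζ.im) Complex.imCLM z := Complex.imCLM.hasFDerivAt
  have h2 : HasDerivAt (fun y : ℝ => (p.re * p.re + p.im * p.im) / y ^ 2)
      (-2 * (p.re * p.re + p.im * p.im) / z.im ^ 3) z.im := by
    have := (hasDerivAt_const z.im (p.re * p.re + p.im * p.im)).div
      ((hasDerivAt_id z.im).pow 2) (by simpa using hz)
    refine this.congr_deriv ?_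
    simp only [Pi.pow_apply, id]
    field_simp
    ring
  have h3 := h2.comp_hasFDerivAt z h1
  have h4 : HasFDerivAt (fun ζ : ℂ => hypMetric ζ p p)
    ((-2 * (p.re * p.re + p.im * p.im) / z.im ^ 3) • Complex.imCLM) z := h3
  rw [h4.fderiv]
  simp
  ring

/-- The geodesic equation written out in real and imaginary parts. -/
theorem isGeodesic_iff (γ : ℝ → ℍ) (hγ : ContDiff ℝ ∞ (fun t => (γ t : ℂ))) :
    IsGeodesic γ ↔ ∀ t, HasDerivAt (fun s => (deriv (fun r => (γ r : ℂ)) s).re / (γ s).im ^ 2) 0 t ∧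
      HasDerivAt (fun s => (deriv (fun r => (γ r : ℂ)) s).im / (γ s).im ^ 2)
        (-((deriv (fun r => (γ r : ℂ)) t).re ^ 2 + (deriv (fun r => (γ r : ℂ)) t).im ^ 2)
          / (γ t).im ^ 3) t := by
  set z : ℝ → ℂ := fun t => (γ t : ℂ) with hz
  have hd : Differentiable ℝ z := hγ.differentiable (by simp)
  have hd2 : Differentiable ℝ (deriv z) :=
    (((contDiff_infty_iff_deriv (𝕜 := ℝ)).1 hγ).2).differentiable (by simp)
  have hy : Differentiable ℝ (fun s => (γ s).im ^ 2) :=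
    (Complex.imCLM.differentiable.comp hd).pow 2
  have hne : ∀ s, (γ s).im ^ 2 ≠ 0 := fun s => pow_ne_zero _ (γ s).im_ne_zero
  have hA : Differentiable ℝ (fun s => (deriv z s).re / (γ s).im ^ 2) :=
    (Complex.reCLM.differentiable.comp hd2).div hy hne
  have hB : Differentiable ℝ (fun s => (deriv z s).im / (γ s).im ^ 2) :=
    (Complex.imCLM.differentiable.comp hd2).div hy hne
  have key : ∀ (t : ℝ) (w : ℂ), deriv (fun s => hypMetric (γ s) (deriv z s) w) t =
      deriv (fun s => (deriv z s).re / (γ s).im ^ 2) t * w.re +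
      deriv (fun s => (deriv z s).im / (γ s).im ^ 2) t * w.im := by
    intro t w
    have := (((hA t).hasDerivAt.mul_const w.re).add ((hB t).hasDerivAt.mul_const w.im)).deriv
    rw [← this]
    congr 1
    funext s
    simp only [hypMetric, UpperHalfPlane.coe_im, Pi.add_apply]
    ring
  constructor
  · rintro ⟨-, h⟩ t
    have e1 := h t 1
    have eI := h t Complex.I
    rw [key, fderiv_hypMetric _ _ _ (by simpa using (γ t).im_ne_zero)] at e1 eI
    simp at e1 eI
    refine ⟨e1 ▸ (hA t).hasDerivAt, ?_⟩
    refine (hB t).hasDerivAt.congr_deriv ?_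
    rw [eI]; ring
  · intro h
    refine ⟨hγ, fun t w => ?_⟩
    rw [key, fderiv_hypMetric _ _ _ (by simpa using (γ t).im_ne_zero), (h t).1.deriv,
      (h t).2.deriv, UpperHalfPlane.coe_im]
    ring

/-- The conformal denominator of the explicit geodesic. -/
def geoDen (x : ℍ) (v : ℂ) (t : ℝ) : ℝ :=
  Real.cosh (‖v‖ / x.im * t) - v.im / ‖v‖ * Real.sinh (‖v‖ / x.im * t)

theorem geoDen_pos (x : ℍ) (v : ℂ) (t : ℝ) : 0 < geoDen x v t := by
  have hb : |v.im / ‖v‖| ≤ 1 := by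
    rw [abs_div, abs_norm]
    exact div_le_one_of_le₀ (Complex.abs_im_le_norm v) (norm_nonneg v)
  have h1 := Real.cosh_sq (‖v‖ / x.im * t)
  have h2 := Real.cosh_pos (‖v‖ / x.im * t)
  unfold geoDen
  set S := Real.sinh (‖v‖ / x.im * t)
  set C := Real.cosh (‖v‖ / x.im * t)
  have h3 : |S| < C := abs_lt_of_sq_lt_sq (by linarith) h2.le
  have h4 : |v.im / ‖v‖ * S| ≤ |S| := by
    rw [abs_mul]; exact mul_le_of_le_one_left (abs_nonneg _) hb
  linarith [le_abs_self (v.im / ‖v‖ * S)]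

/-- The explicit geodesic with initial point `x` and initial velocity `v`. -/
def geo (x : ℍ) (v : ℂ) (t : ℝ) : ℍ :=
  UpperHalfPlane.mk
    ⟨x.re + x.im * (v.re / ‖v‖ * Real.sinh (‖v‖ / x.im * t)) / geoDen x v t,
      x.im / geoDen x v t⟩ (div_pos x.im_pos (geoDen_pos x v t))

theorem geo_hasDerivAt (x : ℍ) (v : ℂ) (t : ℝ) :
    HasDerivAt (fun s => (geo x v s : ℂ))
      ⟨v.re / geoDen x v t ^ 2,
        -(x.im * (‖v‖ / x.im * (Real.sinh (‖v‖ / x.im * t)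
          - v.im / ‖v‖ * Real.cosh (‖v‖ / x.im * t)))) / geoDen x v t ^ 2⟩ t := by
  have hD0 := (geoDen_pos x v t).ne'
  have hx := x.im_ne_zero
  have hl : HasDerivAt (fun s : ℝ => ‖v‖ / x.im * s) (‖v‖ / x.im) t := by
    simpa using (hasDerivAt_id t).const_mul (‖v‖ / x.im)
  have hS := hl.sinh
  have hC := hl.cosh
  have hD : HasDerivAt (geoDen x v) (‖v‖ / x.im * (Real.sinh (‖v‖ / x.im * t)
      - v.im / ‖v‖ * Real.cosh (‖v‖ / x.im * t))) t := by
    refine (hC.sub (hS.const_mul (v.im / ‖v‖))).congr_deriv ?_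
    ring
  have hre := (((hS.const_mul (v.re / ‖v‖)).const_mul x.im).div hD hD0).const_add x.re
  have him := (hasDerivAt_const t x.im).div hD hD0
  have hv : v.re / ‖v‖ * ‖v‖ = v.re := by
    by_cases h : v = 0
    · simp [h]
    · field_simp [norm_ne_zero_iff.2 h]
  have hcs := Real.cosh_sq (‖v‖ / x.im * t)
  have hre' : HasDerivAt (fun s => (geo x v s : ℂ).re) (v.re / geoDen x v t ^ 2) t := by
    refine hre.congr_deriv ?_
    congr 1
    have hk : x.im * (‖v‖ / x.im) = ‖v‖ := by field_simp
    unfold geoDen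
    generalize ‖v‖ / x.im = k at *
    generalize Real.sinh (k * t) = S at *
    generalize Real.cosh (k * t) = C at *
    generalize v.im / ‖v‖ = b at *
    generalize v.re / ‖v‖ = a at *
    linear_combination (a * x.im * k) * hcs + a * hk + hv
  have him' : HasDerivAt (fun s => (geo x v s : ℂ).im)
      (-(x.im * (‖v‖ / x.im * (Real.sinh (‖v‖ / x.im * t)
          - v.im / ‖v‖ * Real.cosh (‖v‖ / x.im * t)))) / geoDen x v t ^ 2) t := by
    refine him.congr_deriv ?_
    ring
  have := (hre'.ofReal_comp).add ((him'.ofReal_comp).mul_const Complex.I)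
  refine (this.congr_deriv ?_).congr_of_eventuallyEq (Filter.Eventually.of_forall fun s => ?_)
  · apply Complex.ext <;>
      simp only [Complex.add_re, Complex.add_im, Complex.mul_re, Complex.mul_im,
        Complex.ofReal_re, Complex.ofReal_im, Complex.I_re, Complex.I_im] <;> ring
  · apply Complex.ext <;> simp

theorem geo_contDiff (x : ℍ) (v : ℂ) : ContDiff ℝ ∞ (fun s => (geo x v s : ℂ)) := by
  have hl : ContDiff ℝ ∞ (fun s : ℝ => ‖v‖ / x.im * s) := contDiff_const.mul contDiff_id
  have hS := hl.sinh
  have hC := hl.cosh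
  have hD : ContDiff ℝ ∞ (geoDen x v) := hC.sub (contDiff_const.mul hS)
  have hne : ∀ s, geoDen x v s ≠ 0 := fun s => (geoDen_pos x v s).ne'
  have hre : ContDiff ℝ ∞ (fun s => (geo x v s : ℂ).re) :=
    contDiff_const.add ((contDiff_const.mul (contDiff_const.mul hS)).div hD hne)
  have him : ContDiff ℝ ∞ (fun s => (geo x v s : ℂ).im) := contDiff_const.div hD hne
  have := (Complex.ofRealCLM.contDiff.comp hre).add
    ((Complex.ofRealCLM.contDiff.comp him).mul (contDiff_const (c := Complex.I)))
  convert this using 2 with s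
  apply Complex.ext <;> simp

theorem geo_isGeodesicFrom (x : ℍ) (v : ℂ) : IsGeodesicFrom x v (geo x v) := by
  have hder : deriv (fun s => (geo x v s : ℂ)) = fun t => ⟨v.re / geoDen x v t ^ 2,
        -(x.im * (‖v‖ / x.im * (Real.sinh (‖v‖ / x.im * t)
          - v.im / ‖v‖ * Real.cosh (‖v‖ / x.im * t)))) / geoDen x v t ^ 2⟩ :=
    funext fun t => (geo_hasDerivAt x v t).deriv
  have hx := x.im_ne_zero
  have him : ∀ t, (geo x v t).im = x.im / geoDen x v t := fun t => rfl
  have hvre : v.re / ‖v‖ * ‖v‖ = v.re := by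
    by_cases h : v = 0
    · simp [h]
    · field_simp [norm_ne_zero_iff.2 h]
  have hvim : v.im / ‖v‖ * ‖v‖ = v.im := by
    by_cases h : v = 0
    · simp [h]
    · field_simp [norm_ne_zero_iff.2 h]
  have hvv : ‖v‖ ^ 2 = v.re ^ 2 + v.im ^ 2 := by
    rw [← Complex.normSq_eq_norm_sq, Complex.normSq_apply]; ring
  refine ⟨(isGeodesic_iff _ (geo_contDiff x v)).2 fun t => ?_, ?_, ?_⟩
  · rw [hder]
    simp only [him]
    have hne : ∀ s, geoDen x v s ≠ 0 := fun s => (geoDen_pos x v s).ne'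
    have hl : HasDerivAt (fun s : ℝ => ‖v‖ / x.im * s) (‖v‖ / x.im) t := by
      simpa using (hasDerivAt_id t).const_mul (‖v‖ / x.im)
    constructor
    · refine (hasDerivAt_const t (v.re / x.im ^ 2)).congr_of_eventuallyEq
        (Filter.Eventually.of_forall fun s => ?_)
      have := hne s
      simp only
      field_simp
    · have h := ((hl.sinh.sub (hl.cosh.const_mul (v.im / ‖v‖))).const_mul (-(‖v‖ / x.im ^ 2)))
      refine (h.congr_deriv ?_).congr_of_eventuallyEq (Filter.Eventually.of_forall fun s => ?_)
      · have hcs := Real.cosh_sq (‖v‖ / x.im * t)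
        have := hne t
        set b := v.im / ‖v‖ with hb
        set S := Real.sinh (‖v‖ / x.im * t)
        set C := Real.cosh (‖v‖ / x.im * t)
        have hD : geoDen x v t = C - b * S := rfl
        set D := geoDen x v t
        have hre2 : v.re ^ 2 = ‖v‖ ^ 2 - (b * ‖v‖) ^ 2 := by rw [hvim]; linarith
        field_simp
        rw [hre2, hD]
        linear_combination (‖v‖ ^ 2 * (b ^ 2 - 1)) * hcs
      · have := hne s
        simp only
        field_simp
        simp
  · apply UpperHalfPlane.ext
    apply Complex.ext <;> simp [geo, geoDen]
  · rw [hder]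
    apply Complex.ext
    · simp [geoDen]
    · simp only [geoDen]
      field_simp
      simp
      linarith

theorem geodesic_unique {x : ℍ} {v : ℂ} {γ δ : ℝ → ℍ}
    (hγ : IsGeodesicFrom x v γ) (hδ : IsGeodesicFrom x v δ) : γ = δ := by
  have main : ∀ γ : ℝ → ℍ, IsGeodesicFrom x v γ →
      (∀ t, HasDerivAt (fun s => ((γ s).im)⁻¹)
          (-((deriv (fun r => (γ r : ℂ)) t).im / (γ t).im ^ 2)) t ∧
        HasDerivAt (fun s => -((deriv (fun r => (γ r : ℂ)) s).im / (γ s).im ^ 2))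
          ((v.re ^ 2 + v.im ^ 2) / x.im ^ 2 * ((γ t).im)⁻¹) t ∧
        HasDerivAt (fun s => (γ s).re) (v.re / x.im ^ 2 * (γ t).im ^ 2) t) := by
    intro γ hγ
    have hc := hγ.1.1
    have hg := (isGeodesic_iff γ hc).1 hγ.1
    have hd : Differentiable ℝ (fun t => (γ t : ℂ)) := hc.differentiable (by simp)
    have h0 := hγ.2.2
    set p := deriv (fun t => (γ t : ℂ)) with hp
    have hre : ∀ t, HasDerivAt (fun s => (γ s).re) (p t).re t := fun t =>
      (Complex.reCLM.hasFDerivAt.comp_hasDerivAt t (hd t).hasDerivAt)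
    have him : ∀ t, HasDerivAt (fun s => (γ s).im) (p t).im t := fun t =>
      (Complex.imCLM.hasFDerivAt.comp_hasDerivAt t (hd t).hasDerivAt)
    have hy : ∀ t, (γ t).im ≠ 0 := fun t => (γ t).im_ne_zero
    have hA : ∀ t, (p t).re / (γ t).im ^ 2 = v.re / x.im ^ 2 := by
      intro t
      have := is_const_of_deriv_eq_zero (fun t => (hg t).1.differentiableAt)
        (fun t => (hg t).1.deriv) t 0
      rw [this, h0, hγ.2.1]
    have hu : ∀ t, HasDerivAt (fun s => ((γ s).im)⁻¹) (-((p t).im / (γ t).im ^ 2)) t := by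
      intro t
      refine ((him t).inv (hy t)).congr_deriv ?_
      ring
    have hE : ∀ t, ((p t).re ^ 2 + (p t).im ^ 2) / (γ t).im ^ 2
        = (v.re ^ 2 + v.im ^ 2) / x.im ^ 2 := by
      have hEd : ∀ t, HasDerivAt (fun s => ((p s).re ^ 2 + (p s).im ^ 2) / (γ s).im ^ 2) 0 t := by
        intro t
        have h1 := ((((hg t).1).pow 2).add (((hg t).2).pow 2)).mul ((him t).pow 2)
        refine (h1.congr_deriv ?_).congr_of_eventuallyEq
          (Filter.Eventually.of_forall fun s => ?_)
        · have := hy t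
          simp only [Pi.add_apply, Pi.pow_apply, Nat.cast_ofNat, Nat.add_one_sub_one, pow_one]
          field_simp
          ring
        · have := hy s
          simp only [Pi.add_apply, Pi.mul_apply, Pi.pow_apply]
          field_simp
      intro t
      have := is_const_of_deriv_eq_zero (fun t => (hEd t).differentiableAt)
        (fun t => (hEd t).deriv) t 0
      rw [this, h0, hγ.2.1]
    intro t
    refine ⟨hu t, ((hg t).2.neg).congr_deriv ?_, (hre t).congr_deriv ?_⟩
    · rw [← hE t]
      have := hy t
      field_simp
    · rw [← hA t]
      have := hy t
      field_simp
  have hγ' := main γ hγ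
  have hδ' := main δ hδ
  set E := (v.re ^ 2 + v.im ^ 2) / x.im ^ 2
  let L : ℝ × ℝ →L[ℝ] ℝ × ℝ :=
    (ContinuousLinearMap.snd ℝ ℝ ℝ).prod (E • ContinuousLinearMap.fst ℝ ℝ ℝ)
  have hu := ODE_solution_unique_univ (v := fun _ q => L q) (s := fun _ => Set.univ) (t₀ := 0)
    (K := ‖L‖₊)
    (f := fun t => (((γ t).im)⁻¹, -((deriv (fun r => (γ r : ℂ)) t).im / (γ t).im ^ 2)))
    (g := fun t => (((δ t).im)⁻¹, -((deriv (fun r => (δ r : ℂ)) t).im / (δ t).im ^ 2)))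
    (fun _ => L.lipschitz.lipschitzOnWith)
    (fun t => ⟨(hγ' t).1.prodMk (hγ' t).2.1, trivial⟩)
    (fun t => ⟨(hδ' t).1.prodMk (hδ' t).2.1, trivial⟩)
    (by simp only [hγ.2.1, hγ.2.2, hδ.2.1, hδ.2.2])
  have him : ∀ t, (γ t).im = (δ t).im := fun t =>
    inv_injective (congrArg Prod.fst (congrFun hu t))
  have hre : ∀ t, (γ t).re = (δ t).re := by
    have hd : ∀ t, HasDerivAt (fun s => (γ s).re - (δ s).re) 0 t := by
      intro t
      refine ((hγ' t).2.2.sub (hδ' t).2.2).congr_deriv ?_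
      rw [him t]; ring
    intro t
    have := is_const_of_deriv_eq_zero (fun t => (hd t).differentiableAt)
      (fun t => (hd t).deriv) t 0
    simp only [hγ.2.1, hδ.2.1, sub_self] at this
    linarith
  funext t
  apply UpperHalfPlane.ext
  exact Complex.ext (hre t) (him t)

/-- Through every tangent vector there is exactly one geodesic `ℝ → ℍ`. -/
theorem existsUnique_geodesic (x : ℍ) (v : ℂ) : ∃! γ : ℝ → ℍ, IsGeodesicFrom x v γ :=
  ⟨geo x v, geo_isGeodesicFrom x v, fun _ h => geodesic_unique h (geo_isGeodesicFrom x v)⟩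

/-- The tangent bundle `Tℍ`. -/
abbrev THyp : Type := TangentBundle 𝓘(ℝ, ℂ) ℍ

instance : Nonempty THyp := ⟨⟨UpperHalfPlane.I, (0 : ℂ)⟩⟩

/-- The exponential map of the hyperbolic plane: `exp(x, v) = γ(1)`, where `γ` is the geodesic with
`γ(0) = x` and `γ'(0) = v`. -/
def hypExp (p : THyp) : ℍ := (existsUnique_geodesic p.1 (p.2 : ℂ)).choose 1

/-- Closed formula for the exponential map. -/
theorem hypExp_eq (p : THyp) : hypExp p = geo p.1 (p.2 : ℂ) 1 :=
  congrFun (geodesic_unique (existsUnique_geodesic p.1 (p.2 : ℂ)).choose_spec.1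
    (geo_isGeodesicFrom p.1 (p.2 : ℂ))) 1

/-! ## The maps `R_θ`, `F_φ` and `I^θ_{(φ₁, φ₂)}` -/

/-- `R_θ (x, v) = (x, e^{iθ} v)`. -/
def rot (θ : ℝ) (p : THyp) : THyp :=
  let v : ℂ := p.2
  ⟨p.1, (Complex.exp (θ * Complex.I) * v : ℂ)⟩

/-- `F_φ (x, v) = (exp(x, v), exp(x, e^{iφ} v))`. -/
def expPair (φ : ℝ) (p : THyp) : ℍ × ℍ := (hypExp p, hypExp (rot φ p))

/-- `I^θ_{(φ₁, φ₂)} = F_{φ₂} ∘ R_θ ∘ F_{φ₁}⁻¹`. -/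
def inscriptionMap (θ φ₁ φ₂ : ℝ) : ℍ × ℍ → ℍ × ℍ :=
  expPair φ₂ ∘ rot θ ∘ Function.invFun (expPair φ₁)

/-! ## Two-forms, pullbacks and the forms `ω`, `ω₁`, `ω₂`, `ω_a` -/

section Forms

variable {E H M E' H' M' : Type*}
  [NormedAddCommGroup E] [NormedSpace ℝ E] [TopologicalSpace H]
  [TopologicalSpace M] [ChartedSpace H M]
  [NormedAddCommGroup E'] [NormedSpace ℝ E'] [TopologicalSpace H']
  [TopologicalSpace M'] [ChartedSpace H' M']

/-- (Not necessarily continuous) differential two-forms on a manifold. -/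
abbrev TwoForm (J : ModelWithCorners ℝ E H) (M : Type*) [TopologicalSpace M] [ChartedSpace H M] :=
  ∀ p : M, TangentSpace J p [⋀^Fin 2]→L[ℝ] ℝ

/-- The pullback `f^* η`. -/
def pullback (J : ModelWithCorners ℝ E H) (J' : ModelWithCorners ℝ E' H') (f : M → M')
    (η : TwoForm J' M') : TwoForm J M :=
  fun p => (η (f p)).compContinuousLinearMap (mfderiv J J' f p)

end Forms

attribute [local instance] Complex.finrank_real_complex_fact

/-- The hyperbolic area form `ω = dx ∧ dy / y²`. -/
def areaForm : TwoForm 𝓘(ℝ, ℂ) ℍ := fun x =>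
  ((x.im ^ 2)⁻¹ • AlternatingMap.mkContinuous (Complex.orientation.volumeForm) 1
    (fun m => by simpa using Complex.orientation.abs_volumeForm_apply_le m) : ℂ [⋀^Fin 2]→L[ℝ] ℝ)

theorem areaForm_apply (x : ℍ) (u w : ℂ) :
    areaForm x ![u, w] = (u.re * w.im - u.im * w.re) / x.im ^ 2 := by
  have h := Complex.areaForm u w
  rw [Orientation.areaForm_to_volumeForm] at h
  change (x.im ^ 2)⁻¹ * Complex.orientation.volumeForm ![u, w] = _
  rw [h]
  simp
  ring

/-- `ω(u, w) = g(j u, w)`: the area form is the one determined by the hyperbolic metric and the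
orientation of `ℂ`. -/
theorem areaForm_eq_metric (x : ℍ) (u w : ℂ) :
    areaForm x ![u, w] = hypMetric x (Complex.I * u) w := by
  rw [areaForm_apply]
  simp [hypMetric]
  ring

/-- The model with corners of `ℍ × ℍ`. -/
abbrev JJ : ModelWithCorners ℝ (ℂ × ℂ) (ModelProd ℂ ℂ) := 𝓘(ℝ, ℂ).prod 𝓘(ℝ, ℂ)

/-- `ω₁ = π₁^* ω`. -/
def omega₁ : TwoForm JJ (ℍ × ℍ) := pullback JJ 𝓘(ℝ, ℂ) Prod.fst areaForm

/-- `ω₂ = π₂^* ω`. -/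
def omega₂ : TwoForm JJ (ℍ × ℍ) := pullback JJ 𝓘(ℝ, ℂ) Prod.snd areaForm

/-- A two-form on `ℍ × ℍ` read in the global chart `ℍ × ℍ ⊆ ℂ × ℂ`. -/
def inChart (η : TwoForm JJ (ℍ × ℍ)) (z : ℂ × ℂ) : (ℂ × ℂ) [⋀^Fin 2]→L[ℝ] ℝ :=
  η (ofComplex z.1, ofComplex z.2)

/-- Symplectic forms on `ℍ × ℍ`: smooth, closed and nondegenerate two-forms. -/
structure IsSymplectic (η : TwoForm JJ (ℍ × ℍ)) : Prop where
  smooth : ContDiffOn ℝ ∞ (inChart η) {z | 0 < z.1.im ∧ 0 < z.2.im}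
  closed : ∀ z : ℂ × ℂ, 0 < z.1.im → 0 < z.2.im → extDeriv (inChart η) z = 0
  nondegenerate : ∀ (p : ℍ × ℍ) (u : TangentSpace JJ p),
    (∀ w : TangentSpace JJ p, η p ![u, w] = 0) → u = 0

/-! ## Jordan curves and Lagrangian tori -/

/-- `γ ⊆ ℍ` is a smooth Jordan curve: the image of the circle under a smooth embedding. -/
def IsSmoothJordanCurve (γ : Set ℍ) : Prop :=
  ∃ c : Circle → ℍ, ContMDiff (𝓡 1) 𝓘(ℝ, ℂ) ∞ c ∧ IsEmbedding c ∧
    (∀ t, Function.Injective (mfderiv (𝓡 1) 𝓘(ℝ, ℂ) c t)) ∧ Set.range c = γ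

/-- The model with corners of the torus `S¹ × S¹`. -/
abbrev JTorus : ModelWithCorners ℝ (EuclideanSpace ℝ (Fin 1) × EuclideanSpace ℝ (Fin 1))
    (ModelProd (EuclideanSpace ℝ (Fin 1)) (EuclideanSpace ℝ (Fin 1))) := (𝓡 1).prod (𝓡 1)

/-- `L ⊆ ℍ × ℍ` is an (embedded) Lagrangian torus for `η`: it is the image of the torus under a
smooth embedding `f` (a topological embedding that is an immersion) with `f^* η = 0`. As the torus
has half the dimension of `ℍ × ℍ`, this says that `L` is a Lagrangian submanifold when `η` is
symplectic. -/
def IsLagrangianTorus (η : TwoForm JJ (ℍ × ℍ)) (L : Set (ℍ × ℍ)) : Prop :=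
  ∃ f : Circle × Circle → ℍ × ℍ, ContMDiff JTorus JJ ∞ f ∧ IsEmbedding f ∧
    (∀ t, Function.Injective (mfderiv JTorus JJ f t)) ∧
    (∀ t, pullback JTorus JJ f η t = 0) ∧ Set.range f = L

/-- The constant `a(θ, φ₁, φ₂)`. -/
def aConst (θ φ₁ φ₂ : ℝ) : ℝ :=
  (Real.sin ((φ₂ + θ) / 2) * Real.sin ((φ₂ + θ - φ₁) / 2)) /
    (Real.sin (θ / 2) * Real.sin ((φ₁ - θ) / 2))

/-- `ω_a = a ω₁ + ω₂`. -/
def omegaA (a : ℝ) : TwoForm JJ (ℍ × ℍ) := fun p => a • omega₁ p + omega₂ p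

end

end HypProd

/-!
The exponential map of `ℍ` becomes algebraic when a tangent vector `v` at `z` is replaced by
`u = (v / |v|) sinh (|v| / z.im)`, the spatial part of a point of the hyperboloid: with
`z = x + iy`, `u = p + iq`, `C = √(1 + |u|²)` and `D = C - q` it is `x + (y / D) (p + i)`
(`expCoord`, `coe_hypExp`). In these coordinates `R_θ` is the rotation of `u` (`rotCoord`).

*Inverting `F_φ`.* Given `P` and `Q`, the apex `z` of the isosceles triangle with base `P`, `Q` and
angle `φ` satisfies the Möbius equation `Q = rotation of P about z by φ`. Its imaginary part is
linear in `x`, and eliminating `x` leaves a quadratic equation for `y` with positive leading and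
negative constant coefficient, hence with exactly one positive root, which depends smoothly on `P`
and `Q`. So `F_φ` is bijective for `0 < φ < 2π`, and its inverse, read in the coordinates `(z, u)`,
is the explicit smooth map `apexCoord φ`. Consequently `I = (E_θ, E_{φ₂ + θ}) ∘ apexCoord φ₁`, where
`E_α = expCoord ∘ rotCoord α`, while `(E_0, E_{φ₁}) ∘ apexCoord φ₁` is the identity.

*The forms.* The pullback of the area form under `expCoord` is
`D / y² dx ∧ dy - 1 / y dx ∧ dD + 1 / y dp ∧ dy + 1 / C dp ∧ dq` (`liftForm_eq`). As `C` and
`dp ∧ dq` are invariant under rotations of `u` and everything else is linear in `(p, q, dp, dq)`,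
the form `E_α^* ω` is affine in `(cos α, sin α)` (`liftForm_rotCoord`). The four vectors
`(1, cos α, sin α)` with `α = 0, θ, φ₁, φ₂ + θ` satisfy one linear relation, with coefficients given
by areas of triangles inscribed in the unit circle (`circle_relation`); it has the shape
`a E_θ^* ω + E_{φ₂ + θ}^* ω = b E_0^* ω + c E_{φ₁}^* ω`, and pulling it back under `apexCoord φ₁`
gives `I^* ω_a = b ω₁ + c ω₂` (`pullback_inscriptionMap_omegaA`).

*Lagrangian tori.* Every `b ω₁ + c ω₂` vanishes on a product of two curves. It is nondegenerate for
`b, c ≠ 0`, so `I` is an immersion, and `I` is injective because `F_{φ₂}` is.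
-/

namespace HypProd

noncomputable section

/-! ### Velocities in hyperboloid coordinates -/

/-- The time component `√(1 + |u|²)` of the point of the hyperboloid over `u`. -/
def lorentz (u : ℂ) : ℝ := √(1 + u.re ^ 2 + u.im ^ 2)

theorem lorentz_sq (u : ℂ) : lorentz u ^ 2 = 1 + u.re ^ 2 + u.im ^ 2 :=
  Real.sq_sqrt (by positivity)

theorem lorentz_pos (u : ℂ) : 0 < lorentz u := Real.sqrt_pos.2 (by positivity)

theorem im_lt_lorentz (u : ℂ) : u.im < lorentz u :=
  lt_of_pow_lt_pow_left₀ 2 (lorentz_pos u).le (by rw [lorentz_sq]; nlinarith [sq_nonneg u.re])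

/-- The exponential map in the coordinates `(z, u)`, where the tangent vector `v` at `z` is encoded
by the vector `u` with the same direction and with `|u| = sinh (|v| / z.im)`. -/
def expCoord (m : ℂ × ℂ) : ℂ :=
  ⟨m.1.re + m.2.re * (m.1.im / (lorentz m.2 - m.2.im)), m.1.im / (lorentz m.2 - m.2.im)⟩

/-- The velocity `u` for which `expCoord (z, u) = P`. -/
def velCoord (z P : ℂ) : ℂ :=
  ⟨(P.re - z.re) / P.im,
    ((1 + ((P.re - z.re) / P.im) ^ 2) * P.im / z.im - z.im / P.im) / 2⟩

theorem expCoord_velCoord {z P : ℂ} (hz : 0 < z.im) (hP : 0 < P.im) :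
    expCoord (z, velCoord z P) = P := by
  have hl : lorentz (velCoord z P) =
      ((1 + ((P.re - z.re) / P.im) ^ 2) * P.im / z.im + z.im / P.im) / 2 := by
    rw [lorentz, Real.sqrt_eq_iff_mul_self_eq (by positivity) (by positivity)]
    simp only [velCoord]
    field_simp
    ring
  have hD : lorentz (velCoord z P) - (velCoord z P).im = z.im / P.im := by
    rw [hl]; simp only [velCoord]; ring
  have hY : z.im / (lorentz (velCoord z P) - (velCoord z P).im) = P.im := by
    rw [hD]; field_simp
  apply Complex.ext
  · simp only [expCoord, hY]
    simp only [velCoord]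
    field_simp
    ring
  · simp only [expCoord, hY]

theorem velCoord_expCoord {z : ℂ} (hz : 0 < z.im) (u : ℂ) : velCoord z (expCoord (z, u)) = u := by
  have hD := sub_pos.2 (im_lt_lorentz u)
  have hq := lorentz_sq u
  have hp : ((expCoord (z, u)).re - z.re) / (expCoord (z, u)).im = u.re := by
    simp only [expCoord]
    field_simp
    ring
  apply Complex.ext
  · exact hp
  · simp only [velCoord, hp]
    simp only [expCoord]
    field_simp
    linear_combination -hq

/-! ### The apex of an isosceles triangle -/

/-- For `k = cot (φ / 2)`, the equation saying that the rotation by `φ` about `z` maps `P` to `Q`,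
with the denominator of the Möbius transformation cleared. -/
def IsApex (k : ℝ) (z P Q : ℂ) : Prop :=
  (P - z.re) * (Q - z.re) + z.im ^ 2 - k * z.im * (Q - P) = 0

theorem isApex_iff {k : ℝ} {z P Q : ℂ} : IsApex k z P Q ↔
    (P.re - z.re) * (Q.re - z.re) - P.im * Q.im + z.im ^ 2 - k * z.im * (Q.re - P.re) = 0 ∧
      (P.re - z.re) * Q.im + P.im * (Q.re - z.re) - k * z.im * (Q.im - P.im) = 0 := by
  rw [IsApex, Complex.ext_iff]
  simp [pow_two]

/-- The Möbius equation determines the image point: the coefficient of `Q` in it does not vanish, as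
its imaginary part is that of `P`. -/
theorem IsApex.right_unique {k : ℝ} {z P Q Q' : ℂ} (hP : 0 < P.im) (h : IsApex k z P Q)
    (h' : IsApex k z P Q') : Q = Q' := by
  have hne : P - z.re - k * z.im ≠ 0 := fun h0 => by
    have := congrArg Complex.im h0
    simp at this
    exact hP.ne' this
  refine mul_left_cancel₀ hne ?_
  unfold IsApex at h h'
  linear_combination h - h'

/-- Rotating the velocity of a geodesic from `z` by `φ` rotates its endpoint by `φ` about `z`. -/
theorem isApex_expCoord {φ : ℝ} (hφ : Real.sin (φ / 2) ≠ 0) (z u : ℂ) :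
    IsApex (Real.cos (φ / 2) / Real.sin (φ / 2)) z (expCoord (z, u))
      (expCoord (z, Complex.exp (φ * Complex.I) * u)) := by
  have hs : Real.sin φ = 2 * Real.sin (φ / 2) * Real.cos (φ / 2) := by
    rw [← Real.sin_two_mul]; ring_nf
  have hc : Real.cos φ = Real.cos (φ / 2) ^ 2 - Real.sin (φ / 2) ^ 2 := by
    rw [← Real.cos_two_mul']; ring_nf
  have h1 := Real.sin_sq_add_cos_sq (φ / 2)
  set w := Complex.exp (φ * Complex.I) * u with hw
  have hre : w.re = u.re * Real.cos φ - u.im * Real.sin φ := by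
    rw [hw, Complex.mul_re, Complex.exp_ofReal_mul_I_re, Complex.exp_ofReal_mul_I_im]; ring
  have him : w.im = u.re * Real.sin φ + u.im * Real.cos φ := by
    rw [hw, Complex.mul_im, Complex.exp_ofReal_mul_I_re, Complex.exp_ofReal_mul_I_im]; ring
  have hl : lorentz w = lorentz u := by
    unfold lorentz
    rw [hre, him]
    congr 1
    linear_combination (u.re ^ 2 + u.im ^ 2) * Real.sin_sq_add_cos_sq φ
  have hD := (sub_pos.2 (im_lt_lorentz u)).ne'
  have hD' := (sub_pos.2 (im_lt_lorentz w)).ne'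
  have hq := lorentz_sq u
  rw [hl] at hD'
  rw [isApex_iff]
  simp only [expCoord, hl]
  rw [him] at hD' ⊢
  rw [hre]
  rw [hs, hc] at *
  generalize Real.sin (φ / 2) = s at *
  generalize Real.cos (φ / 2) = c at *
  generalize lorentz u = C at *
  obtain ⟨p, q⟩ := u
  simp only at *
  constructor
  · field_simp
    grind
  · field_simp
    grind

/-- Real part of the apex as a function of its imaginary part `y`, from the imaginary part of the
apex equation. -/
def apexRe (k : ℝ) (P Q : ℂ) (y : ℝ) : ℝ :=
  (P.re * Q.im + Q.re * P.im) / (P.im + Q.im) - k * ((Q.im - P.im) / (P.im + Q.im)) * y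

/-- Leading coefficient of the quadratic equation for the imaginary part of the apex. -/
def apexA (k : ℝ) (P Q : ℂ) : ℝ := 1 + (k * ((Q.im - P.im) / (P.im + Q.im))) ^ 2

/-- Minus the middle coefficient of the quadratic equation for the imaginary part of the apex. -/
def apexB (k : ℝ) (P Q : ℂ) : ℝ :=
  k * (Q.re - P.re) * (1 - ((Q.im - P.im) / (P.im + Q.im)) ^ 2)

/-- Minus the constant coefficient of the quadratic equation for the imaginary part of the apex;
positive by `apexC_pos`. -/
def apexC (P Q : ℂ) : ℝ := P.im * Q.im * (1 + ((Q.re - P.re) / (P.im + Q.im)) ^ 2)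

/-- The positive root of the quadratic equation `A y² - B y - C = 0` for the imaginary part of the
apex. -/
def apexIm (k : ℝ) (P Q : ℂ) : ℝ :=
  (apexB k P Q + √(apexB k P Q ^ 2 + 4 * apexA k P Q * apexC P Q)) / (2 * apexA k P Q)

/-- The apex `z` of the isosceles triangle with base `P`, `Q` and angle `φ` at `z`, where
`k = cot (φ / 2)`. -/
def apex (k : ℝ) (P Q : ℂ) : ℂ := ⟨apexRe k P Q (apexIm k P Q), apexIm k P Q⟩

theorem apexA_pos (k : ℝ) (P Q : ℂ) : 0 < apexA k P Q := by unfold apexA; positivity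

theorem apexC_pos {P Q : ℂ} (hP : 0 < P.im) (hQ : 0 < Q.im) : 0 < apexC P Q := by
  unfold apexC; positivity

theorem apex_disc_pos (k : ℝ) {P Q : ℂ} (hP : 0 < P.im) (hQ : 0 < Q.im) :
    0 < apexB k P Q ^ 2 + 4 * apexA k P Q * apexC P Q := by
  have := apexA_pos k P Q
  have := apexC_pos hP hQ
  positivity

theorem apex_im_pos (k : ℝ) {P Q : ℂ} (hP : 0 < P.im) (hQ : 0 < Q.im) : 0 < (apex k P Q).im := by
  have hA := apexA_pos k P Q
  have hC := apexC_pos hP hQ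
  refine div_pos ?_ (by positivity)
  have : |apexB k P Q| < √(apexB k P Q ^ 2 + 4 * apexA k P Q * apexC P Q) := by
    rw [← Real.sqrt_sq_eq_abs]
    exact Real.sqrt_lt_sqrt (sq_nonneg _) (by linarith [mul_pos hA hC])
  linarith [neg_abs_le (apexB k P Q)]

/-- The imaginary part of the apex equation is linear in `z.re`; substituting its solution into the
real part leaves a quadratic equation for `z.im`. -/
theorem isApex_iff_quadratic {k : ℝ} {z P Q : ℂ} (hP : 0 < P.im) (hQ : 0 < Q.im) :
    IsApex k z P Q ↔ z.re = apexRe k P Q z.im ∧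
      apexA k P Q * z.im ^ 2 - apexB k P Q * z.im - apexC P Q = 0 := by
  have h : P.im + Q.im ≠ 0 := by positivity
  have h1 : z.re = apexRe k P Q z.im ↔
      (P.re - z.re) * Q.im + P.im * (Q.re - z.re) - k * z.im * (Q.im - P.im) = 0 := by
    unfold apexRe
    rw [← sub_eq_zero]
    field_simp
    rw [← neg_eq_zero]
    ring_nf
  rw [isApex_iff, ← h1, and_comm]
  refine and_congr_right fun hx => ?_
  rw [hx]
  unfold apexRe apexA apexB apexC
  field_simp
  ring_nf

theorem isApex_apex (k : ℝ) {P Q : ℂ} (hP : 0 < P.im) (hQ : 0 < Q.im) :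
    IsApex k (apex k P Q) P Q := by
  rw [isApex_iff_quadratic hP hQ]
  refine ⟨rfl, ?_⟩
  have hA := (apexA_pos k P Q).ne'
  have hs := Real.sq_sqrt (apex_disc_pos k hP hQ).le
  simp only [apex, apexIm]
  generalize √(apexB k P Q ^ 2 + 4 * apexA k P Q * apexC P Q) = R at *
  field_simp
  linear_combination hs

/-- `apex k P Q` is the only solution of the apex equation in the upper half-plane. -/
theorem IsApex.eq_apex {k : ℝ} {z P Q : ℂ} (hz : 0 < z.im) (hP : 0 < P.im) (hQ : 0 < Q.im)
    (h : IsApex k z P Q) : z = apex k P Q := by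
  have h' := (isApex_iff_quadratic hP hQ).1 (isApex_apex k hP hQ)
  rw [isApex_iff_quadratic hP hQ] at h
  have hy := apex_im_pos k hP hQ
  have hA := apexA_pos k P Q
  have hC := apexC_pos hP hQ
  have him : z.im = (apex k P Q).im := by
    generalize (apex k P Q).im = y at *
    -- The two roots of the quadratic equation have negative product, so only one is positive.
    have h3 : (z.im - y) * (apexA k P Q * z.im * y + apexC P Q) = 0 := by
      linear_combination y * h.2 - z.im * h'.2
    have h4 := mul_pos (mul_pos hA hz) hy
    rcases mul_eq_zero.1 h3 with h5 | h5 <;> linarith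
  exact Complex.ext (by rw [h.1, him, ← h'.1]) him

/-! ### The area form pulled back to the coordinates `(z, u)` -/

/-- Rotation of the velocity by `θ` in the coordinates `(z, u)`. -/
def rotCoord (θ : ℝ) : ℂ × ℂ →L[ℝ] ℂ × ℂ :=
  (ContinuousLinearMap.fst ℝ ℂ ℂ).prod
    (Complex.exp (θ * Complex.I) • ContinuousLinearMap.snd ℝ ℂ ℂ)

theorem rotCoord_apply (θ : ℝ) (m : ℂ × ℂ) :
    rotCoord θ m = (m.1, Complex.exp (θ * Complex.I) * m.2) := rfl

theorem rotCoord_snd_re (θ : ℝ) (m : ℂ × ℂ) :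
    (rotCoord θ m).2.re = m.2.re * Real.cos θ - m.2.im * Real.sin θ := by
  rw [rotCoord_apply, Complex.mul_re, Complex.exp_ofReal_mul_I_re, Complex.exp_ofReal_mul_I_im]
  ring

theorem rotCoord_snd_im (θ : ℝ) (m : ℂ × ℂ) :
    (rotCoord θ m).2.im = m.2.re * Real.sin θ + m.2.im * Real.cos θ := by
  rw [rotCoord_apply, Complex.mul_im, Complex.exp_ofReal_mul_I_re, Complex.exp_ofReal_mul_I_im]
  ring

theorem rotCoord_zero (m : ℂ × ℂ) : rotCoord 0 m = m := by
  simp [rotCoord_apply]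

theorem rotCoord_rotCoord (θ φ : ℝ) (m : ℂ × ℂ) :
    rotCoord φ (rotCoord θ m) = rotCoord (φ + θ) m := by
  simp only [rotCoord_apply]
  rw [← mul_assoc, ← Complex.exp_add]
  push_cast
  ring_nf

theorem lorentz_rotCoord (θ : ℝ) (m : ℂ × ℂ) : lorentz (rotCoord θ m).2 = lorentz m.2 := by
  unfold lorentz
  rw [rotCoord_snd_re, rotCoord_snd_im]
  congr 1
  linear_combination (m.2.re ^ 2 + m.2.im ^ 2) * Real.sin_sq_add_cos_sq θ

/-- The pullback of the area form under `expCoord`. In the coordinates `z = x + iy`, `u = p + iq`,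
with `C = lorentz u` and `D = C - q`, it is
`D / y² dx ∧ dy - 1 / y dx ∧ dD + 1 / y dp ∧ dy + 1 / C dp ∧ dq`. -/
def liftForm (m U W : ℂ × ℂ) : ℝ :=
  (lorentz m.2 - m.2.im) / m.1.im ^ 2 * (U.1.re * W.1.im - U.1.im * W.1.re) -
    (U.1.re * ((m.2.re * W.2.re + m.2.im * W.2.im) / lorentz m.2 - W.2.im) -
      W.1.re * ((m.2.re * U.2.re + m.2.im * U.2.im) / lorentz m.2 - U.2.im)) / m.1.im +
    (U.2.re * W.1.im - U.1.im * W.2.re) / m.1.im +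
    (U.2.re * W.2.im - U.2.im * W.2.re) / lorentz m.2

theorem contDiff_lorentz : ContDiff ℝ ∞ lorentz :=
  (((contDiff_const.add (Complex.reCLM.contDiff.pow 2)).add (Complex.imCLM.contDiff.pow 2))).sqrt
    fun u => ne_of_gt (by simp only [Complex.reCLM_apply, Complex.imCLM_apply]; positivity)

theorem contDiffOn_complex_mk {E : Type*} [NormedAddCommGroup E] [NormedSpace ℝ E] {s : Set E}
    {f g : E → ℝ} (hf : ContDiffOn ℝ ∞ f s) (hg : ContDiffOn ℝ ∞ g s) :
    ContDiffOn ℝ ∞ (fun e => (⟨f e, g e⟩ : ℂ)) s :=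
  Complex.equivRealProdCLM.symm.contDiff.comp_contDiffOn (hf.prodMk hg)

theorem contDiff_expCoord : ContDiff ℝ ∞ expCoord := by
  have h1 : ContDiff ℝ ∞ (fun m : ℂ × ℂ => m.1.re) := Complex.reCLM.contDiff.comp contDiff_fst
  have h2 : ContDiff ℝ ∞ (fun m : ℂ × ℂ => m.1.im) := Complex.imCLM.contDiff.comp contDiff_fst
  have h3 : ContDiff ℝ ∞ (fun m : ℂ × ℂ => m.2.re) := Complex.reCLM.contDiff.comp contDiff_snd
  have h4 : ContDiff ℝ ∞ (fun m : ℂ × ℂ => m.2.im) := Complex.imCLM.contDiff.comp contDiff_snd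
  have h5 : ContDiff ℝ ∞ (fun m : ℂ × ℂ => lorentz m.2 - m.2.im) :=
    (contDiff_lorentz.comp contDiff_snd).sub h4
  have h6 := h2.div h5 fun m => (sub_pos.2 (im_lt_lorentz m.2)).ne'
  exact contDiffOn_univ.1 (contDiffOn_complex_mk (h1.add (h3.mul h6)).contDiffOn h6.contDiffOn)

/-- The differential of `expCoord`, with `X = x + p Y` kept unexpanded in the real part. -/
theorem fderiv_expCoord (m U : ℂ × ℂ) :
    (fderiv ℝ expCoord m U).im = U.1.im / (lorentz m.2 - m.2.im) -
      m.1.im * ((m.2.re * U.2.re + m.2.im * U.2.im) / lorentz m.2 - U.2.im) /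
        (lorentz m.2 - m.2.im) ^ 2 ∧
    (fderiv ℝ expCoord m U).re = U.1.re + U.2.re * (m.1.im / (lorentz m.2 - m.2.im)) +
      m.2.re * (fderiv ℝ expCoord m U).im := by
  have hD := (sub_pos.2 (im_lt_lorentz m.2)).ne'
  -- Differentiate along the line `t ↦ m + t U`.
  have hl (f : ℂ →L[ℝ] ℝ) (z w : ℂ) : HasDerivAt (fun t : ℝ => f (z + t • w)) (f w) 0 := by
    have h : HasDerivAt (fun t : ℝ => z + t • w) w 0 := by
      simpa using ((hasDerivAt_id (0 : ℝ)).smul_const w).const_add z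
    exact f.hasFDerivAt.comp_hasDerivAt (0 : ℝ) h
  have hline : HasDerivAt (fun t : ℝ => m + t • U) U 0 := by
    simpa using (((hasDerivAt_id (0 : ℝ)).smul_const U).const_add m)
  have hF : HasDerivAt (fun t : ℝ => expCoord (m + t • U)) (fderiv ℝ expCoord m U) 0 := by
    have h := (contDiff_expCoord.differentiable (by simp) (m + (0 : ℝ) • U)).hasFDerivAt
    rw [show fderiv ℝ expCoord m = fderiv ℝ expCoord (m + (0 : ℝ) • U) by simp]
    exact h.comp_hasDerivAt (0 : ℝ) hline
  have hx := hl Complex.reCLM m.1 U.1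
  have hy := hl Complex.imCLM m.1 U.1
  have hp := hl Complex.reCLM m.2 U.2
  have hq := hl Complex.imCLM m.2 U.2
  have hC := ((((hp.pow 2).const_add 1).add (hq.pow 2))).sqrt
    (ne_of_gt (by simp; positivity))
  have hC' : HasDerivAt (fun t : ℝ => lorentz (m.2 + t • U.2))
      ((m.2.re * U.2.re + m.2.im * U.2.im) / lorentz m.2) 0 := by
    refine hC.congr_deriv ?_
    simp [lorentz]
    field_simp
  have hY := hy.div (hC'.sub hq) (by simpa using hD)
  have hX := hx.add (hp.mul hY)
  have him := (Complex.imCLM.hasFDerivAt.comp_hasDerivAt (0 : ℝ) hF).unique hY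
  have hre := (Complex.reCLM.hasFDerivAt.comp_hasDerivAt (0 : ℝ) hF).unique hX
  rw [← him] at hre
  simp at him hre
  rw [hre, him]
  refine ⟨by field_simp, by ring⟩

/-- `liftForm` is the pullback of `dX ∧ dY / Y²` under `expCoord = X + iY`. -/
theorem liftForm_eq {m : ℂ × ℂ} (hm : 0 < m.1.im) (U W : ℂ × ℂ) :
    ((fderiv ℝ expCoord m U).re * (fderiv ℝ expCoord m W).im -
      (fderiv ℝ expCoord m U).im * (fderiv ℝ expCoord m W).re) / (expCoord m).im ^ 2 =
    liftForm m U W := by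
  have hD := (sub_pos.2 (im_lt_lorentz m.2)).ne'
  have hC := (lorentz_pos m.2).ne'
  have hC2 := lorentz_sq m.2
  rw [(fderiv_expCoord m U).2, (fderiv_expCoord m W).2, (fderiv_expCoord m U).1,
    (fderiv_expCoord m W).1]
  simp only [expCoord, liftForm]
  generalize lorentz m.2 = C at *
  field_simp
  ring

/-- Rotating the velocity changes the pulled back area form by an affine function of
`(cos θ, sin θ)`. -/
theorem liftForm_rotCoord (m U W : ℂ × ℂ) : ∃ A B S : ℝ, ∀ θ : ℝ,
    liftForm (rotCoord θ m) (rotCoord θ U) (rotCoord θ W) =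
      A + Real.cos θ * B + Real.sin θ * S := by
  set C := lorentz m.2 with hC
  refine ⟨C / m.1.im ^ 2 * (U.1.re * W.1.im - U.1.im * W.1.re) -
    (U.1.re * ((m.2.re * W.2.re + m.2.im * W.2.im) / C) -
      W.1.re * ((m.2.re * U.2.re + m.2.im * U.2.im) / C)) / m.1.im +
    (U.2.re * W.2.im - U.2.im * W.2.re) / C,
    -m.2.im / m.1.im ^ 2 * (U.1.re * W.1.im - U.1.im * W.1.re) +
      (U.1.re * W.2.im - W.1.re * U.2.im) / m.1.im + (U.2.re * W.1.im - U.1.im * W.2.re) / m.1.im,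
    -m.2.re / m.1.im ^ 2 * (U.1.re * W.1.im - U.1.im * W.1.re) +
      (U.1.re * W.2.re - W.1.re * U.2.re) / m.1.im - (U.2.im * W.1.im - U.1.im * W.2.im) / m.1.im,
    fun θ => ?_⟩
  have h1 := Real.sin_sq_add_cos_sq θ
  unfold liftForm
  rw [lorentz_rotCoord, rotCoord_snd_re, rotCoord_snd_im, rotCoord_snd_re, rotCoord_snd_im,
    rotCoord_snd_re, rotCoord_snd_im, ← hC]
  simp only [rotCoord_apply]
  linear_combination (-(U.1.re * ((m.2.re * W.2.re + m.2.im * W.2.im) / C) -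
      W.1.re * ((m.2.re * U.2.re + m.2.im * U.2.im) / C)) / m.1.im +
    (U.2.re * W.2.im - U.2.im * W.2.re) / C) * h1

/-! ### Four points on a circle -/

/-- The linear relation between the four vectors `(1, cos α, sin α)` for `α = 0, θ, φ, ψ`. -/
theorem circle_relation {θ φ ψ : ℝ} (h1 : Real.sin (θ / 2) ≠ 0) (h2 : Real.sin (φ / 2) ≠ 0)
    (h3 : Real.sin ((φ - θ) / 2) ≠ 0) (A B S : ℝ) :
    Real.sin (ψ / 2) * Real.sin ((ψ - φ) / 2) / (Real.sin (θ / 2) * Real.sin ((φ - θ) / 2)) *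
        (A + Real.cos θ * B + Real.sin θ * S) + (A + Real.cos ψ * B + Real.sin ψ * S) =
      Real.sin ((ψ - φ) / 2) * Real.sin ((ψ - θ) / 2) / (Real.sin (θ / 2) * Real.sin (φ / 2)) *
        (A + Real.cos 0 * B + Real.sin 0 * S) +
      Real.sin (ψ / 2) * Real.sin ((ψ - θ) / 2) / (Real.sin (φ / 2) * Real.sin ((φ - θ) / 2)) *
        (A + Real.cos φ * B + Real.sin φ * S) := by
  have e1 (α : ℝ) : Real.sin α = 2 * Real.sin (α / 2) * Real.cos (α / 2) := by
    rw [← Real.sin_two_mul]; ring_nf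
  have e2 (α : ℝ) : Real.cos α = 1 - 2 * Real.sin (α / 2) ^ 2 := by
    rw [← Real.cos_two_mul_eq_one_sub]; ring_nf
  rw [e1 θ, e2 θ, e1 φ, e2 φ, e1 ψ, e2 ψ, Real.cos_zero, Real.sin_zero]
  rw [sub_div φ θ, Real.sin_sub] at h3
  rw [sub_div, sub_div, sub_div, Real.sin_sub, Real.sin_sub, Real.sin_sub]
  have c1 := Real.sin_sq_add_cos_sq (θ / 2)
  have c2 := Real.sin_sq_add_cos_sq (φ / 2)
  have c3 := Real.sin_sq_add_cos_sq (ψ / 2)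
  generalize Real.sin (θ / 2) = s1 at *
  generalize Real.cos (θ / 2) = t1 at *
  generalize Real.sin (φ / 2) = s2 at *
  generalize Real.cos (φ / 2) = t2 at *
  generalize Real.sin (ψ / 2) = s3 at *
  generalize Real.cos (ψ / 2) = t3 at *
  field_simp
  grind

/-! ### The exponential map and `F_φ` in hyperboloid coordinates -/

/-- The tangent vector `v` at `z` in the coordinates `(z, u)`, `u = (v / |v|) sinh (|v| / z.im)`. -/
def toCoord (p : THyp) : ℂ × ℂ :=
  let v : ℂ := p.2
  (p.1, (Real.sinh (‖v‖ / p.1.im) / ‖v‖) • v)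

/-- The closed formula for geodesics only involves `sinh (|v| / z.im)`, the direction of `v` and
`cosh (|v| / z.im) = lorentz u`. -/
theorem coe_hypExp (p : THyp) : (hypExp p : ℂ) = expCoord (toCoord p) := by
  obtain ⟨x, v⟩ := p
  change ℂ at v
  rw [hypExp_eq]
  have hvv : v.re ^ 2 + v.im ^ 2 = ‖v‖ ^ 2 := by
    rw [← Complex.normSq_eq_norm_sq, Complex.normSq_apply]; ring
  have hl : lorentz ((Real.sinh (‖v‖ / x.im) / ‖v‖) • v) = Real.cosh (‖v‖ / x.im) := by
    rw [lorentz, Real.sqrt_eq_iff_mul_self_eq (by positivity) (Real.cosh_pos _).le]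
    rw [← pow_two, Real.cosh_sq, Complex.smul_re, Complex.smul_im]
    rcases eq_or_ne v 0 with rfl | hv
    · simp
    · have := norm_ne_zero_iff.2 hv
      simp only [smul_eq_mul]
      field_simp
      linear_combination Real.sinh (‖v‖ / x.im) ^ 2 * hvv
  have hD : geoDen x v 1 = lorentz ((Real.sinh (‖v‖ / x.im) / ‖v‖) • v) -
      ((Real.sinh (‖v‖ / x.im) / ‖v‖) • v).im := by
    rw [hl, geoDen, Complex.smul_im, smul_eq_mul, mul_one]
    ring
  apply Complex.ext
  · simp only [expCoord, toCoord, geo, ← hD, Complex.smul_re, smul_eq_mul, mul_one]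
    simp
    ring
  · simp only [expCoord, toCoord, geo, ← hD]
    simp

theorem toCoord_rot (θ : ℝ) (p : THyp) : toCoord (rot θ p) = rotCoord θ (toCoord p) := by
  obtain ⟨x, v⟩ := p
  change ℂ at v
  simp [toCoord, rot, rotCoord_apply, Complex.norm_exp_ofReal_mul_I, mul_left_comm]

theorem toCoord_fst_im_pos (p : THyp) : 0 < (toCoord p).1.im := p.1.im_pos

theorem norm_toCoord_snd (x : ℍ) (v : ℂ) :
    ‖(toCoord ⟨x, v⟩).2‖ = Real.sinh (‖v‖ / x.im) := by
  have h0 : 0 ≤ Real.sinh (‖v‖ / x.im) :=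
    Real.sinh_nonneg_iff.2 (div_nonneg (norm_nonneg _) x.im_pos.le)
  simp only [toCoord, norm_smul, norm_div, Real.norm_eq_abs, abs_norm, abs_of_nonneg h0]
  rcases eq_or_ne v 0 with rfl | hv
  · simp
  · have := norm_ne_zero_iff.2 hv
    field_simp

theorem toCoord_injective : Function.Injective toCoord := by
  rintro ⟨x, v⟩ ⟨y, w⟩ h
  change ℂ at v w
  obtain rfl : x = y := UpperHalfPlane.ext (congrArg Prod.fst h)
  have hn : ‖v‖ = ‖w‖ := by
    have h1 := norm_toCoord_snd x v
    rw [h, norm_toCoord_snd, Real.sinh_inj] at h1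
    exact ((div_left_inj' x.im_ne_zero).1 h1).symm
  have h2 : (Real.sinh (‖v‖ / x.im) / ‖v‖) • v = (Real.sinh (‖w‖ / x.im) / ‖w‖) • w :=
    congrArg Prod.snd h
  rcases eq_or_ne v 0 with rfl | hv
  · rw [norm_zero, eq_comm, norm_eq_zero] at hn
    rw [hn]
  · rw [← hn] at h2
    have h3 : Real.sinh (‖v‖ / x.im) / ‖v‖ ≠ 0 :=
      (div_pos (Real.sinh_pos_iff.2 (div_pos (norm_pos_iff.2 hv) x.im_pos))
        (norm_pos_iff.2 hv)).ne'
    rw [smul_right_injective ℂ h3 h2]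

theorem exists_toCoord_eq {m : ℂ × ℂ} (hm : 0 < m.1.im) : ∃ p : THyp, toCoord p = m := by
  obtain ⟨z, u⟩ := m
  refine ⟨⟨⟨z, hm⟩, ((z.im * Real.arsinh ‖u‖ / ‖u‖) • u : ℂ)⟩, ?_⟩
  rcases eq_or_ne u 0 with rfl | hu
  · simp [toCoord]
  · have hu' := norm_pos_iff.2 hu
    have ha : 0 < Real.arsinh ‖u‖ := Real.arsinh_pos_iff.2 hu'
    change 0 < z.im at hm
    have hn : ‖(z.im * Real.arsinh ‖u‖ / ‖u‖) • u‖ = z.im * Real.arsinh ‖u‖ := by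
      rw [norm_smul, Real.norm_of_nonneg (by positivity)]
      field_simp
    have him : (⟨z, hm⟩ : ℍ).im = z.im := rfl
    simp only [toCoord, hn, him]
    rw [mul_div_cancel_left₀ _ hm.ne', Real.sinh_arsinh, smul_smul]
    have : ‖u‖ / (z.im * Real.arsinh ‖u‖) * (z.im * Real.arsinh ‖u‖ / ‖u‖) = 1 := by
      field_simp
    rw [this, one_smul]

/-- The inverse of `F_φ` in the coordinates `(z, u)`, meaningful for `sin (φ / 2) ≠ 0`. -/
def apexCoord (φ : ℝ) (p : ℍ × ℍ) : ℂ × ℂ :=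
  (apex (Real.cos (φ / 2) / Real.sin (φ / 2)) p.1 p.2,
    velCoord (apex (Real.cos (φ / 2) / Real.sin (φ / 2)) p.1 p.2) p.1)

theorem apexCoord_fst_im_pos (φ : ℝ) (p : ℍ × ℍ) : 0 < (apexCoord φ p).1.im :=
  apex_im_pos _ p.1.im_pos p.2.im_pos

theorem expCoord_apexCoord (φ : ℝ) (p : ℍ × ℍ) : expCoord (apexCoord φ p) = p.1 :=
  expCoord_velCoord (apexCoord_fst_im_pos φ p) p.1.im_pos

theorem expCoord_rotCoord_apexCoord {φ : ℝ} (hφ : Real.sin (φ / 2) ≠ 0) (p : ℍ × ℍ) :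
    expCoord (rotCoord φ (apexCoord φ p)) = p.2 := by
  have h := isApex_expCoord hφ (apexCoord φ p).1 (apexCoord φ p).2
  rw [Prod.mk.eta, expCoord_apexCoord] at h
  exact h.right_unique p.1.im_pos (isApex_apex _ p.1.im_pos p.2.im_pos)

theorem coe_expPair_fst (φ : ℝ) (t : THyp) : ((expPair φ t).1 : ℂ) = expCoord (toCoord t) :=
  coe_hypExp t

theorem coe_expPair_snd (φ : ℝ) (t : THyp) :
    ((expPair φ t).2 : ℂ) = expCoord (rotCoord φ (toCoord t)) := by
  rw [← toCoord_rot, ← coe_hypExp]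
  rfl

theorem apexCoord_expPair {φ : ℝ} (hφ : Real.sin (φ / 2) ≠ 0) (t : THyp) :
    apexCoord φ (expPair φ t) = toCoord t := by
  have h := isApex_expCoord hφ (toCoord t).1 (toCoord t).2
  rw [← rotCoord_apply, ← coe_expPair_snd, Prod.mk.eta, ← coe_expPair_fst φ] at h
  have hz := h.eq_apex (toCoord_fst_im_pos t) (expPair φ t).1.im_pos (expPair φ t).2.im_pos
  unfold apexCoord
  rw [← hz, coe_expPair_fst, ← Prod.mk.eta (p := toCoord t),
    velCoord_expCoord (toCoord_fst_im_pos t)]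

theorem expPair_bijective {φ : ℝ} (hφ : Real.sin (φ / 2) ≠ 0) :
    Function.Bijective (expPair φ) := by
  refine ⟨fun s t h => toCoord_injective ?_, fun p => ?_⟩
  · rw [← apexCoord_expPair hφ, h, apexCoord_expPair hφ]
  · obtain ⟨t, ht⟩ := exists_toCoord_eq (apexCoord_fst_im_pos φ p)
    refine ⟨t, Prod.ext (UpperHalfPlane.ext ?_) (UpperHalfPlane.ext ?_)⟩
    · rw [coe_expPair_fst, ht, expCoord_apexCoord]
    · rw [coe_expPair_snd, ht, expCoord_rotCoord_apexCoord hφ]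

theorem rot_bijective (θ : ℝ) : Function.Bijective (rot θ) := by
  have h (α β : ℝ) (hαβ : β + α = 0) (p : THyp) : rot β (rot α p) = p :=
    toCoord_injective (by rw [toCoord_rot, toCoord_rot, rotCoord_rotCoord, hαβ, rotCoord_zero])
  exact ⟨Function.LeftInverse.injective (h θ (-θ) (by simp)),
    Function.RightInverse.surjective (h (-θ) θ (by simp))⟩

theorem toCoord_invFun_expPair {φ : ℝ} (hφ : Real.sin (φ / 2) ≠ 0) (p : ℍ × ℍ) :
    toCoord (Function.invFun (expPair φ) p) = apexCoord φ p := by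
  rw [← apexCoord_expPair hφ, Function.rightInverse_invFun (expPair_bijective hφ).2]

theorem coe_inscriptionMap_fst {θ φ₁ : ℝ} (φ₂ : ℝ) (hφ : Real.sin (φ₁ / 2) ≠ 0) (p : ℍ × ℍ) :
    ((inscriptionMap θ φ₁ φ₂ p).1 : ℂ) = expCoord (rotCoord θ (apexCoord φ₁ p)) := by
  rw [← toCoord_invFun_expPair hφ, ← toCoord_rot]
  exact coe_expPair_fst _ _

theorem coe_inscriptionMap_snd {θ φ₁ : ℝ} (φ₂ : ℝ) (hφ : Real.sin (φ₁ / 2) ≠ 0) (p : ℍ × ℍ) :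
    ((inscriptionMap θ φ₁ φ₂ p).2 : ℂ) = expCoord (rotCoord (φ₂ + θ) (apexCoord φ₁ p)) := by
  rw [← toCoord_invFun_expPair hφ, ← rotCoord_rotCoord, ← toCoord_rot]
  exact coe_expPair_snd _ _

theorem inscriptionMap_injective {θ φ₁ φ₂ : ℝ} (hφ₁ : Real.sin (φ₁ / 2) ≠ 0)
    (hφ₂ : Real.sin (φ₂ / 2) ≠ 0) : Function.Injective (inscriptionMap θ φ₁ φ₂) :=
  (expPair_bijective hφ₂).1.comp ((rot_bijective θ).1.comp
    (Function.rightInverse_invFun (expPair_bijective hφ₁).2).injective)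

/-! ### Smoothness -/

theorem contMDiff_real_coe : ContMDiff 𝓘(ℝ, ℂ) 𝓘(ℝ, ℂ) ∞ ((↑) : ℍ → ℂ) :=
  contMDiff_isOpenEmbedding isOpenEmbedding_coe

theorem contMDiff_of_coe {E H M : Type*} [NormedAddCommGroup E] [NormedSpace ℝ E]
    [TopologicalSpace H] {J : ModelWithCorners ℝ E H} [TopologicalSpace M] [ChartedSpace H M]
    {f : M → ℍ} (hf : ContMDiff J 𝓘(ℝ, ℂ) ∞ (fun p => (f p : ℂ))) :
    ContMDiff J 𝓘(ℝ, ℂ) ∞ f :=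
  ContMDiff.of_comp_isOpenEmbedding isOpenEmbedding_coe hf

/-- The single chart of `ℍ` is the inclusion, so the differential of the inclusion is the identity. -/
theorem mfderiv_real_coe (z : ℍ) (v : ℂ) :
    (mfderiv 𝓘(ℝ, ℂ) 𝓘(ℝ, ℂ) ((↑) : ℍ → ℂ) z : ℂ →L[ℝ] ℂ) v = v := by
  have h : HasMFDerivAt 𝓘(ℝ, ℂ) 𝓘(ℝ, ℂ) ((↑) : ℍ → ℂ) z (ContinuousLinearMap.id ℝ ℂ) := by
    refine ⟨UpperHalfPlane.continuous_coe.continuousAt,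
      (hasFDerivWithinAt_id _ _).congr_of_eventuallyEq ?_
        ((extChartAt 𝓘(ℝ, ℂ) z).right_inv (mem_extChartAt_target z))⟩
    refine Filter.mem_of_superset (mem_nhdsWithin_of_mem_nhds
      ((extChartAt_target_mem_nhds (I := 𝓘(ℝ, ℂ)) z))) fun w hw => ?_
    exact (extChartAt 𝓘(ℝ, ℂ) z).right_inv hw
  rw [h.mfderiv]
  rfl

theorem mfderiv_coe_comp {E H M : Type*} [NormedAddCommGroup E] [NormedSpace ℝ E]
    [TopologicalSpace H] {J : ModelWithCorners ℝ E H} [TopologicalSpace M] [ChartedSpace H M]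
    {f : M → ℍ} {p : M} (hf : MDifferentiableAt J 𝓘(ℝ, ℂ) f p) (v : TangentSpace J p) :
    (mfderiv J 𝓘(ℝ, ℂ) (fun q => (f q : ℂ)) p v : ℂ) = mfderiv J 𝓘(ℝ, ℂ) f p v := by
  have h := mfderiv_comp p (contMDiff_real_coe.mdifferentiable (by simp) (f p)) hf
  have h' : (fun q => (f q : ℂ)) = ((↑) : ℍ → ℂ) ∘ f := rfl
  rw [h', h]
  exact mfderiv_real_coe _ _

theorem contDiffOn_apex (k : ℝ) :
    ContDiffOn ℝ ∞ (fun p : ℂ × ℂ => apex k p.1 p.2) {p | 0 < p.1.im ∧ 0 < p.2.im} := by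
  set s : Set (ℂ × ℂ) := {p | 0 < p.1.im ∧ 0 < p.2.im}
  have h1 : ContDiffOn ℝ ∞ (fun p : ℂ × ℂ => p.1.re) s :=
    (Complex.reCLM.contDiff.comp contDiff_fst).contDiffOn
  have h2 : ContDiffOn ℝ ∞ (fun p : ℂ × ℂ => p.1.im) s :=
    (Complex.imCLM.contDiff.comp contDiff_fst).contDiffOn
  have h3 : ContDiffOn ℝ ∞ (fun p : ℂ × ℂ => p.2.re) s :=
    (Complex.reCLM.contDiff.comp contDiff_snd).contDiffOn
  have h4 : ContDiffOn ℝ ∞ (fun p : ℂ × ℂ => p.2.im) s :=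
    (Complex.imCLM.contDiff.comp contDiff_snd).contDiffOn
  have hne : ∀ p ∈ s, p.1.im + p.2.im ≠ 0 := fun p hp => (add_pos hp.1 hp.2).ne'
  have hm := (h4.sub h2).div (h2.add h4) hne
  have hA : ContDiffOn ℝ ∞ (fun p : ℂ × ℂ => apexA k p.1 p.2) s :=
    contDiffOn_const.add ((contDiffOn_const.mul hm).pow 2)
  have hB : ContDiffOn ℝ ∞ (fun p : ℂ × ℂ => apexB k p.1 p.2) s :=
    (contDiffOn_const.mul (h3.sub h1)).mul (contDiffOn_const.sub (hm.pow 2))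
  have hC : ContDiffOn ℝ ∞ (fun p : ℂ × ℂ => apexC p.1 p.2) s :=
    (h2.mul h4).mul (contDiffOn_const.add (((h3.sub h1).div (h2.add h4) hne).pow 2))
  have hy : ContDiffOn ℝ ∞ (fun p : ℂ × ℂ => apexIm k p.1 p.2) s :=
    (hB.add (((hB.pow 2).add ((contDiffOn_const.mul hA).mul hC)).sqrt
      fun p hp => (apex_disc_pos k hp.1 hp.2).ne')).div (contDiffOn_const.mul hA)
      fun p _ => (mul_pos two_pos (apexA_pos k p.1 p.2)).ne'
  have hx : ContDiffOn ℝ ∞ (fun p : ℂ × ℂ => apexRe k p.1 p.2 (apexIm k p.1 p.2)) s :=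
    (((h1.mul h4).add (h3.mul h2)).div (h2.add h4) hne).sub ((contDiffOn_const.mul hm).mul hy)
  exact contDiffOn_complex_mk hx hy

theorem contDiffOn_velCoord :
    ContDiffOn ℝ ∞ (fun p : ℂ × ℂ => velCoord p.1 p.2) {p | 0 < p.1.im ∧ 0 < p.2.im} := by
  set s : Set (ℂ × ℂ) := {p | 0 < p.1.im ∧ 0 < p.2.im}
  have h1 : ContDiffOn ℝ ∞ (fun p : ℂ × ℂ => p.1.re) s :=
    (Complex.reCLM.contDiff.comp contDiff_fst).contDiffOn
  have h2 : ContDiffOn ℝ ∞ (fun p : ℂ × ℂ => p.1.im) s :=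
    (Complex.imCLM.contDiff.comp contDiff_fst).contDiffOn
  have h3 : ContDiffOn ℝ ∞ (fun p : ℂ × ℂ => p.2.re) s :=
    (Complex.reCLM.contDiff.comp contDiff_snd).contDiffOn
  have h4 : ContDiffOn ℝ ∞ (fun p : ℂ × ℂ => p.2.im) s :=
    (Complex.imCLM.contDiff.comp contDiff_snd).contDiffOn
  have hp := (h3.sub h1).div h4 fun p hp => hp.2.ne'
  exact contDiffOn_complex_mk hp (((((contDiffOn_const.add (hp.pow 2)).mul h4).div h2
    fun p hp => hp.1.ne').sub (h2.div h4 fun p hp => hp.2.ne')).div contDiffOn_const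
    fun _ _ => two_ne_zero)

theorem contMDiff_apexCoord (φ : ℝ) : ContMDiff JJ 𝓘(ℝ, ℂ × ℂ) ∞ (apexCoord φ) := by
  set k := Real.cos (φ / 2) / Real.sin (φ / 2)
  have ha := contDiffOn_apex k
  have h : ContDiffOn ℝ ∞ (fun p : ℂ × ℂ => (apex k p.1 p.2, velCoord (apex k p.1 p.2) p.1))
      {p | 0 < p.1.im ∧ 0 < p.2.im} :=
    ha.prodMk (contDiffOn_velCoord.comp (ha.prodMk contDiff_fst.contDiffOn)
      fun p hp => ⟨apex_im_pos k hp.1 hp.2, hp.1⟩)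
  have hc : ContMDiff JJ 𝓘(ℝ, ℂ × ℂ) ∞ (fun p : ℍ × ℍ => ((p.1 : ℂ), (p.2 : ℂ))) :=
    (contMDiff_real_coe.comp contMDiff_fst).prodMk_space (contMDiff_real_coe.comp contMDiff_snd)
  exact contMDiffOn_univ.1 (h.contMDiffOn.comp hc.contMDiffOn
    fun p _ => ⟨p.1.im_pos, p.2.im_pos⟩)

theorem contMDiff_expCoord_rotCoord_apexCoord (φ θ : ℝ) :
    ContMDiff JJ 𝓘(ℝ, ℂ) ∞ (fun p => expCoord (rotCoord θ (apexCoord φ p))) :=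
  (contDiff_expCoord.comp (rotCoord θ).contDiff).contMDiff.comp (contMDiff_apexCoord φ)

theorem contMDiff_inscriptionMap {θ φ₁ : ℝ} (φ₂ : ℝ) (hφ : Real.sin (φ₁ / 2) ≠ 0) :
    ContMDiff JJ JJ ∞ (inscriptionMap θ φ₁ φ₂) := by
  refine ContMDiff.prodMk (contMDiff_of_coe ?_) (contMDiff_of_coe ?_)
  · exact (contMDiff_expCoord_rotCoord_apexCoord φ₁ θ).congr (coe_inscriptionMap_fst φ₂ hφ)
  · exact (contMDiff_expCoord_rotCoord_apexCoord φ₁ (φ₂ + θ)).congr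
      (coe_inscriptionMap_snd φ₂ hφ)

/-! ### The forms `ω_a` -/

theorem pullback_apply {E H M E' H' M' : Type*}
    [NormedAddCommGroup E] [NormedSpace ℝ E] [TopologicalSpace H]
    [TopologicalSpace M] [ChartedSpace H M]
    [NormedAddCommGroup E'] [NormedSpace ℝ E'] [TopologicalSpace H']
    [TopologicalSpace M'] [ChartedSpace H' M']
    (J : ModelWithCorners ℝ E H) (J' : ModelWithCorners ℝ E' H') (f : M → M') (η : TwoForm J' M')
    (p : M) (u w : TangentSpace J p) :
    pullback J J' f η p ![u, w] = η (f p) ![mfderiv J J' f p u, mfderiv J J' f p w] := by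
  simp only [pullback, ContinuousAlternatingMap.compContinuousLinearMap_apply]
  congr 1
  ext i
  fin_cases i <;> rfl

theorem twoForm_ext {V : Type*} [AddCommGroup V] [Module ℝ V] [TopologicalSpace V]
    {α β : V [⋀^Fin 2]→L[ℝ] ℝ} (h : ∀ u w, α ![u, w] = β ![u, w]) : α = β := by
  ext m
  have hm : m = ![m 0, m 1] := by ext i; fin_cases i <;> rfl
  rw [hm, h]

theorem omega₁_apply (p : ℍ × ℍ) (u w : ℂ × ℂ) :
    omega₁ p ![u, w] = areaForm p.1 ![u.1, w.1] := by
  have h := pullback_apply JJ 𝓘(ℝ, ℂ) Prod.fst areaForm p u w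
  rw [mfderiv_fst] at h
  exact h

theorem omega₂_apply (p : ℍ × ℍ) (u w : ℂ × ℂ) :
    omega₂ p ![u, w] = areaForm p.2 ![u.2, w.2] := by
  have h := pullback_apply JJ 𝓘(ℝ, ℂ) Prod.snd areaForm p u w
  rw [mfderiv_snd] at h
  exact h

theorem omegaA_apply (a : ℝ) (p : ℍ × ℍ) (u w : ℂ × ℂ) :
    omegaA a p ![u, w] = a * areaForm p.1 ![u.1, w.1] + areaForm p.2 ![u.2, w.2] := by
  rw [← omega₁_apply, ← omega₂_apply]
  rfl

/-- Nondegeneracy of `b ω₁ + c ω₂`. -/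
theorem area_combination_nondegenerate {b c : ℝ} (hb : b ≠ 0) (hc : c ≠ 0) (p : ℍ × ℍ) (u : ℂ × ℂ)
    (h : ∀ w : ℂ × ℂ, b * areaForm p.1 ![u.1, w.1] + c * areaForm p.2 ![u.2, w.2] = 0) :
    u = 0 := by
  have key (x : ℍ) (v : ℂ) (hv : ∀ w : ℂ, areaForm x ![v, w] = 0) : v = 0 := by
    have h1 := hv 1
    have h2 := hv Complex.I
    rw [areaForm_apply, div_eq_zero_iff, or_iff_left (pow_ne_zero _ x.im_ne_zero)] at h1 h2
    simp at h1 h2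
    exact Complex.ext h2 h1
  have hz (x : ℍ) (v : ℂ) : areaForm x ![v, (0 : ℂ)] = 0 := by simp [areaForm_apply]
  refine Prod.ext (key p.1 _ fun w => ?_) (key p.2 _ fun w => ?_)
  · have := h (w, 0)
    rw [hz, mul_zero, add_zero] at this
    exact (mul_eq_zero.1 this).resolve_left hb
  · have := h (0, w)
    rw [hz, mul_zero, zero_add] at this
    exact (mul_eq_zero.1 this).resolve_left hc

/-- The constant form `dx ∧ dy` on `ℂ`, realised as the hyperbolic area form at `i`. -/
def stdForm : ℂ [⋀^Fin 2]→L[ℝ] ℝ := areaForm UpperHalfPlane.I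

theorem stdForm_apply (u w : ℂ) : stdForm ![u, w] = u.re * w.im - u.im * w.re := by
  refine (areaForm_apply UpperHalfPlane.I u w).trans ?_
  simp

theorem stdForm_comp_apply (L : ℂ × ℂ →L[ℝ] ℂ) (m : Fin 2 → ℂ × ℂ) :
    stdForm.compContinuousLinearMap L m =
      (L (m 0)).re * (L (m 1)).im - (L (m 0)).im * (L (m 1)).re := by
  rw [← stdForm_apply, ContinuousAlternatingMap.compContinuousLinearMap_apply]
  congr 1
  ext i
  fin_cases i <;> rfl

theorem inChart_omegaA (a : ℝ) {z : ℂ × ℂ} (h1 : 0 < z.1.im) (h2 : 0 < z.2.im) :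
    inChart (omegaA a) z =
      (a * (z.1.im ^ 2)⁻¹) • stdForm.compContinuousLinearMap (ContinuousLinearMap.fst ℝ ℂ ℂ) +
        (z.2.im ^ 2)⁻¹ • stdForm.compContinuousLinearMap (ContinuousLinearMap.snd ℝ ℂ ℂ) := by
  refine twoForm_ext fun u w => ?_
  have h := omegaA_apply a (⟨z.1, h1⟩, ⟨z.2, h2⟩) u w
  rw [areaForm_apply, areaForm_apply] at h
  rw [ContinuousAlternatingMap.add_apply, ContinuousAlternatingMap.smul_apply,
    ContinuousAlternatingMap.smul_apply, stdForm_comp_apply, stdForm_comp_apply]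
  rw [inChart, ofComplex_apply_of_im_pos h1, ofComplex_apply_of_im_pos h2]
  refine h.trans ?_
  simp only [ContinuousLinearMap.coe_fst', ContinuousLinearMap.coe_snd', smul_eq_mul,
    Matrix.cons_val_zero, Matrix.cons_val_one]
  change _ * (_ / z.1.im ^ 2) + _ / z.2.im ^ 2 = _
  ring

theorem isSymplectic_omegaA {a : ℝ} (ha : a ≠ 0) : IsSymplectic (omegaA a) where
  smooth := by
    have h1 : ContDiff ℝ ∞ (fun z : ℂ × ℂ => z.1.im ^ 2) :=
      (Complex.imCLM.contDiff.comp contDiff_fst).pow 2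
    have h2 : ContDiff ℝ ∞ (fun z : ℂ × ℂ => z.2.im ^ 2) :=
      (Complex.imCLM.contDiff.comp contDiff_snd).pow 2
    refine ContDiffOn.congr ?_ fun z hz => inChart_omegaA a hz.1 hz.2
    exact ((contDiffOn_const.mul (h1.contDiffOn.inv fun z hz => pow_ne_zero _ hz.1.ne')).smul
      contDiffOn_const).add ((h2.contDiffOn.inv fun z hz => pow_ne_zero _ hz.2.ne').smul
      contDiffOn_const)
  closed := by
    intro z h1 h2
    have hev : inChart (omegaA a) =ᶠ[𝓝 z] fun z =>
        (a * (z.1.im ^ 2)⁻¹) • stdForm.compContinuousLinearMap (ContinuousLinearMap.fst ℝ ℂ ℂ) +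
          (z.2.im ^ 2)⁻¹ • stdForm.compContinuousLinearMap (ContinuousLinearMap.snd ℝ ℂ ℂ) := by
      have o1 : IsOpen {z : ℂ × ℂ | 0 < z.1.im} :=
        isOpen_lt continuous_const (Complex.continuous_im.comp continuous_fst)
      have o2 : IsOpen {z : ℂ × ℂ | 0 < z.2.im} :=
        isOpen_lt continuous_const (Complex.continuous_im.comp continuous_snd)
      filter_upwards [o1.mem_nhds h1, o2.mem_nhds h2] with w hw1 hw2
      exact inChart_omegaA a hw1 hw2
    have hg (y : ℝ) (hy : 0 < y) : HasDerivAt (fun y : ℝ => (y ^ 2)⁻¹) (-2 / y ^ 3) y := by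
      refine ((hasDerivAt_id y).pow 2 |>.inv (by simpa using hy.ne')).congr_deriv ?_
      simp
      field_simp
    have hf1 := ((hg z.1.im h1).const_mul a).comp_hasFDerivAt z
      (Complex.imCLM.comp (ContinuousLinearMap.fst ℝ ℂ ℂ)).hasFDerivAt
    have hf2 := (hg z.2.im h2).comp_hasFDerivAt z
      (Complex.imCLM.comp (ContinuousLinearMap.snd ℝ ℂ ℂ)).hasFDerivAt
    have hd := (hf1.smul_const
      (stdForm.compContinuousLinearMap (ContinuousLinearMap.fst ℝ ℂ ℂ))).add (hf2.smul_const
      (stdForm.compContinuousLinearMap (ContinuousLinearMap.snd ℝ ℂ ℂ)))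
    rw [hev.extDeriv_eq, extDeriv]
    refine (congrArg _ hd.fderiv).trans ?_
    ext v
    rw [ContinuousAlternatingMap.alternatizeUncurryFin_apply, Fin.sum_univ_three]
    simp only [add_apply, ContinuousLinearMap.smulRight_apply,
      ContinuousAlternatingMap.add_apply, ContinuousAlternatingMap.smul_apply, stdForm_comp_apply]
    simp [Fin.removeNth, Fin.succAbove]
    ring
  nondegenerate := by
    intro p u h
    refine area_combination_nondegenerate ha one_ne_zero p u fun w => ?_
    rw [one_mul]
    exact (omegaA_apply a p u w).symm.trans (h w)

/-! ### The pullback of `ω_a` -/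

/-- If `f = E_α ∘ apexCoord φ`, then `f^* ω` is the pullback of `E_α^* ω` under `apexCoord φ`. -/
theorem areaForm_mfderiv_of_lift {φ α : ℝ} {f : ℍ × ℍ → ℍ}
    (hf : ∀ p, (f p : ℂ) = expCoord (rotCoord α (apexCoord φ p))) (p : ℍ × ℍ) (u w : ℂ × ℂ) :
    let T : ℂ × ℂ →L[ℝ] ℂ × ℂ := mfderiv JJ 𝓘(ℝ, ℂ × ℂ) (apexCoord φ) p
    areaForm (f p) ![mfderiv JJ 𝓘(ℝ, ℂ) f p u, mfderiv JJ 𝓘(ℝ, ℂ) f p w] =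
      liftForm (rotCoord α (apexCoord φ p)) (rotCoord α (T u)) (rotCoord α (T w)) := by
  intro T
  have hs : ContMDiff JJ 𝓘(ℝ, ℂ) ∞ f := contMDiff_of_coe
    ((contMDiff_expCoord_rotCoord_apexCoord φ α).congr hf)
  have hd : ∀ v : ℂ × ℂ, mfderiv JJ 𝓘(ℝ, ℂ) f p v =
      fderiv ℝ expCoord (rotCoord α (apexCoord φ p)) (rotCoord α (T v)) := by
    intro v
    rw [← mfderiv_coe_comp (hs.mdifferentiable (by simp) p) v]
    have hE : HasFDerivAt (fun m => expCoord (rotCoord α m))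
        ((fderiv ℝ expCoord (rotCoord α (apexCoord φ p))).comp (rotCoord α)) (apexCoord φ p) :=
      ((contDiff_expCoord.differentiable (by simp) _).hasFDerivAt).comp _ (rotCoord α).hasFDerivAt
    have hT := ((contMDiff_apexCoord φ).mdifferentiable (by simp) p).hasMFDerivAt
    have h := (hE.hasMFDerivAt.comp p hT).mfderiv
    rw [funext hf]
    exact congrArg (fun L : ℂ × ℂ →L[ℝ] ℂ => L v) h
  refine (areaForm_apply (f p) _ _).trans ?_
  have hpos : 0 < (rotCoord α (apexCoord φ p)).1.im := apexCoord_fst_im_pos φ p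
  rw [← liftForm_eq hpos, ← hf p, ← hd u, ← hd w]
  rfl

theorem mfderiv_inscriptionMap {θ φ₁ : ℝ} (φ₂ : ℝ) (hφ : Real.sin (φ₁ / 2) ≠ 0) (p : ℍ × ℍ)
    (u : ℂ × ℂ) :
    (mfderiv JJ JJ (inscriptionMap θ φ₁ φ₂) p u : ℂ × ℂ) =
      (mfderiv JJ 𝓘(ℝ, ℂ) (fun q => (inscriptionMap θ φ₁ φ₂ q).1) p u,
        mfderiv JJ 𝓘(ℝ, ℂ) (fun q => (inscriptionMap θ φ₁ φ₂ q).2) p u) := by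
  have h := (contMDiff_inscriptionMap (θ := θ) φ₂ hφ).mdifferentiable (by simp) p
  exact congrArg (fun L : ℂ × ℂ →L[ℝ] ℂ × ℂ => L u) (mfderiv_prodMk h.fst h.snd)

/-- `I^* ω_a = b ω₁ + c ω₂`, with explicit `b` and `c`. -/
theorem pullback_inscriptionMap_omegaA {θ φ₁ φ₂ : ℝ} (h1 : Real.sin (θ / 2) ≠ 0)
    (h2 : Real.sin (φ₁ / 2) ≠ 0) (h3 : Real.sin ((φ₁ - θ) / 2) ≠ 0) (p : ℍ × ℍ) (u w : ℂ × ℂ) :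
    pullback JJ JJ (inscriptionMap θ φ₁ φ₂) (omegaA (aConst θ φ₁ φ₂)) p ![u, w] =
      Real.sin ((φ₂ + θ - φ₁) / 2) * Real.sin ((φ₂ + θ - θ) / 2) /
          (Real.sin (θ / 2) * Real.sin (φ₁ / 2)) * areaForm p.1 ![u.1, w.1] +
      Real.sin ((φ₂ + θ) / 2) * Real.sin ((φ₂ + θ - θ) / 2) /
          (Real.sin (φ₁ / 2) * Real.sin ((φ₁ - θ) / 2)) * areaForm p.2 ![u.2, w.2] := by
  let T : ℂ × ℂ →L[ℝ] ℂ × ℂ := mfderiv JJ 𝓘(ℝ, ℂ × ℂ) (apexCoord φ₁) p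
  have e1 := areaForm_mfderiv_of_lift (coe_inscriptionMap_fst (θ := θ) φ₂ h2) p u w
  have e2 := areaForm_mfderiv_of_lift (coe_inscriptionMap_snd (θ := θ) φ₂ h2) p u w
  -- The projections are themselves of the form `E_α ∘ apexCoord φ₁`, for `α = 0` and `α = φ₁`.
  have e3 := areaForm_mfderiv_of_lift (φ := φ₁) (α := 0) (f := Prod.fst)
    (fun p => by rw [rotCoord_zero, expCoord_apexCoord]) p u w
  have e4 := areaForm_mfderiv_of_lift (φ := φ₁) (α := φ₁) (f := Prod.snd)
    (fun p => (expCoord_rotCoord_apexCoord h2 p).symm) p u w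
  rw [mfderiv_fst] at e3
  rw [mfderiv_snd] at e4
  have e3' : areaForm p.1 ![u.1, w.1] = _ := e3
  have e4' : areaForm p.2 ![u.2, w.2] = _ := e4
  obtain ⟨A, B, S, hABS⟩ := liftForm_rotCoord (apexCoord φ₁ p) (T u) (T w)
  have e := circle_relation (ψ := φ₂ + θ) h1 h2 h3 A B S
  rw [← hABS, ← hABS, ← hABS, ← hABS] at e
  refine (pullback_apply JJ JJ _ _ p u w).trans ?_
  refine (omegaA_apply _ _ _ _).trans ?_
  rw [e3', e4', ← e, ← e1, ← e2, aConst]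
  have hu := mfderiv_inscriptionMap (θ := θ) φ₂ h2 p u
  have hw := mfderiv_inscriptionMap (θ := θ) φ₂ h2 p w
  rw [hu, hw]

/-! ### Lagrangian tori -/

/-- A two-form vanishes on the image of a line. -/
theorem areaForm_map_line (x : ℍ) (L : EuclideanSpace ℝ (Fin 1) →L[ℝ] ℂ)
    (u w : EuclideanSpace ℝ (Fin 1)) : areaForm x ![L u, L w] = 0 := by
  have h (v : EuclideanSpace ℝ (Fin 1)) : v = v 0 • EuclideanSpace.single 0 (1 : ℝ) := by
    ext i
    fin_cases i
    simp
  rw [areaForm_apply, h u, h w, map_smul, map_smul]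
  simp
  ring_nf
  simp

theorem mfderiv_prodMap_curve {c : Circle → ℍ} (hc : ContMDiff (𝓡 1) 𝓘(ℝ, ℂ) ∞ c)
    (t : Circle × Circle) (u : EuclideanSpace ℝ (Fin 1) × EuclideanSpace ℝ (Fin 1)) :
    (mfderiv JTorus JJ (Prod.map c c) t u : ℂ × ℂ) =
      (mfderiv (𝓡 1) 𝓘(ℝ, ℂ) c t.1 u.1, mfderiv (𝓡 1) 𝓘(ℝ, ℂ) c t.2 u.2) := by
  have h := hc.mdifferentiable (by simp)
  exact congrArg (fun L : EuclideanSpace ℝ (Fin 1) × EuclideanSpace ℝ (Fin 1) →L[ℝ] ℂ × ℂ => L u)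
    (mfderiv_prodMap (h t.1) (h t.2))

theorem mfderiv_prodMap_curve_injective {c : Circle → ℍ} (hc : ContMDiff (𝓡 1) 𝓘(ℝ, ℂ) ∞ c)
    (hi : ∀ t, Function.Injective (mfderiv (𝓡 1) 𝓘(ℝ, ℂ) c t)) (t : Circle × Circle) :
    Function.Injective (mfderiv JTorus JJ (Prod.map c c) t) := by
  intro u w h
  have h' := (mfderiv_prodMap_curve hc t u).symm.trans (h.trans (mfderiv_prodMap_curve hc t w))
  exact Prod.ext (hi t.1 (congrArg Prod.fst h')) (hi t.2 (congrArg Prod.snd h'))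

theorem area_prodMap_curve {c : Circle → ℍ} (hc : ContMDiff (𝓡 1) 𝓘(ℝ, ℂ) ∞ c)
    (t : Circle × Circle) (u w : EuclideanSpace ℝ (Fin 1) × EuclideanSpace ℝ (Fin 1)) :
    let L : EuclideanSpace ℝ (Fin 1) × EuclideanSpace ℝ (Fin 1) →L[ℝ] ℂ × ℂ :=
      mfderiv JTorus JJ (Prod.map c c) t
    areaForm (c t.1) ![(L u).1, (L w).1] = 0 ∧ areaForm (c t.2) ![(L u).2, (L w).2] = 0 := by
  intro L
  have hu : L u = _ := mfderiv_prodMap_curve hc t u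
  have hw : L w = _ := mfderiv_prodMap_curve hc t w
  rw [hu, hw]
  exact ⟨areaForm_map_line _ _ _ _, areaForm_map_line _ _ _ _⟩

theorem isLagrangianTorus_prod (a : ℝ) {γ : Set ℍ} (hγ : IsSmoothJordanCurve γ) :
    IsLagrangianTorus (omegaA a) (γ ×ˢ γ) := by
  obtain ⟨c, hc, he, hi, rfl⟩ := hγ
  refine ⟨Prod.map c c, hc.prodMap hc, he.prodMap he, mfderiv_prodMap_curve_injective hc hi,
    fun t => twoForm_ext fun u w => ?_, Set.range_prodMap⟩
  have h := area_prodMap_curve hc t u w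
  refine (pullback_apply JTorus JJ _ _ t u w).trans ((omegaA_apply a _ _ _).trans ?_)
  erw [h.1, h.2]
  simp

/-- An injective smooth map `I` that pulls `ω_a` back to a combination `b ω₁ + c ω₂` with non-zero
coefficients is an immersion by nondegeneracy, and `b ω₁ + c ω₂` vanishes on products of curves. -/
theorem isLagrangianTorus_image_prod {a b c : ℝ} (hb : b ≠ 0) (hc : c ≠ 0) {I : ℍ × ℍ → ℍ × ℍ}
    (hI : ContMDiff JJ JJ ∞ I) (hinj : Function.Injective I)
    (hpull : ∀ (p : ℍ × ℍ) (u w : ℂ × ℂ), pullback JJ JJ I (omegaA a) p ![u, w] =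
      b * areaForm p.1 ![u.1, w.1] + c * areaForm p.2 ![u.2, w.2])
    {γ : Set ℍ} (hγ : IsSmoothJordanCurve γ) :
    IsLagrangianTorus (omegaA a) (I '' (γ ×ˢ γ)) := by
  obtain ⟨κ, hκ, he, hi, rfl⟩ := hγ
  have hf : ContMDiff JTorus JJ ∞ (Prod.map κ κ) := hκ.prodMap hκ
  have hIf := hI.comp hf
  have hcomp (t : Circle × Circle) : mfderiv JTorus JJ (I ∘ Prod.map κ κ) t =
      (mfderiv JJ JJ I (Prod.map κ κ t)).comp (mfderiv JTorus JJ (Prod.map κ κ) t) :=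
    mfderiv_comp t (hI.mdifferentiable (by simp) _) (hf.mdifferentiable (by simp) t)
  have himm (p : ℍ × ℍ) : Function.Injective (mfderiv JJ JJ I p) := by
    refine (injective_iff_map_eq_zero (mfderiv JJ JJ I p)).2 fun u hu => ?_
    refine area_combination_nondegenerate hb hc p u fun w => ?_
    refine (hpull p u w).symm.trans ((pullback_apply JJ JJ I (omegaA a) p u w).trans ?_)
    rw [hu]
    exact (omegaA a (I p)).map_coord_zero 0 rfl
  refine ⟨I ∘ Prod.map κ κ, hIf, (hIf.continuous.isClosedEmbedding
    (hinj.comp (he.prodMap he).injective)).isEmbedding, fun t => ?_,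
    fun t => twoForm_ext fun u w => ?_, ?_⟩
  · rw [hcomp]
    exact (himm _).comp (mfderiv_prodMap_curve_injective hκ hi t)
  · have h := area_prodMap_curve hκ t u w
    refine (pullback_apply JTorus JJ _ _ t u w).trans ?_
    rw [hcomp]
    refine ((pullback_apply JJ JJ I (omegaA a) (Prod.map κ κ t) _ _).symm.trans
      (hpull _ _ _)).trans ?_
    erw [h.1, h.2]
    simp
  · rw [Set.range_comp, Set.range_prodMap]

end

end HypProd

theorem proposition2p5 (θ φ₁ φ₂ : ℝ) (hθ : 0 < θ) (hθφ₁ : θ < φ₁) (hφ₁ : φ₁ ≤ Real.pi)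
    (hφ₂ : φ₁ < φ₂ + θ) (hφ₂' : φ₂ + θ < 2 * Real.pi) :
    Function.Bijective (HypProd.expPair φ₁) ∧
    ContMDiff HypProd.JJ HypProd.JJ ∞ (HypProd.inscriptionMap θ φ₁ φ₂) ∧
    HypProd.aConst θ φ₁ φ₂ ≠ 0 ∧
    HypProd.IsSymplectic (HypProd.omegaA (HypProd.aConst θ φ₁ φ₂)) ∧
    (∃ b c : ℝ, b ≠ 0 ∧ c ≠ 0 ∧
      ∀ p : ℍ × ℍ, HypProd.pullback HypProd.JJ HypProd.JJ (HypProd.inscriptionMap θ φ₁ φ₂)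
          (HypProd.omegaA (HypProd.aConst θ φ₁ φ₂)) p =
        b • HypProd.omega₁ p + c • HypProd.omega₂ p) ∧
    ∀ γ : Set ℍ, HypProd.IsSmoothJordanCurve γ →
      HypProd.IsLagrangianTorus (HypProd.omegaA (HypProd.aConst θ φ₁ φ₂)) (γ ×ˢ γ) ∧
      HypProd.IsLagrangianTorus (HypProd.omegaA (HypProd.aConst θ φ₁ φ₂))
        (HypProd.inscriptionMap θ φ₁ φ₂ '' (γ ×ˢ γ)) := by
  have hs {α : ℝ} (h0 : 0 < α) (h1 : α < 2 * Real.pi) : Real.sin (α / 2) ≠ 0 :=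
    (Real.sin_pos_of_pos_of_lt_pi (by linarith) (by linarith)).ne'
  have s1 := hs hθ (by linarith)
  have s2 := hs (hθ.trans hθφ₁) (by linarith)
  have s3 := hs (sub_pos.2 hθφ₁) (by linarith)
  have s4 := hs (α := φ₂ + θ) (by linarith) hφ₂'
  have s5 := hs (sub_pos.2 hφ₂) (by linarith)
  have s6 : Real.sin ((φ₂ + θ - θ) / 2) ≠ 0 := hs (by linarith) (by linarith)
  have s7 : Real.sin (φ₂ / 2) ≠ 0 := hs (by linarith) (by linarith)
  have ha : HypProd.aConst θ φ₁ φ₂ ≠ 0 := div_ne_zero (mul_ne_zero s4 s5) (mul_ne_zero s1 s3)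
  have hb := div_ne_zero (mul_ne_zero s5 s6) (mul_ne_zero s1 s2)
  have hc := div_ne_zero (mul_ne_zero s4 s6) (mul_ne_zero s2 s3)
  have hI := HypProd.contMDiff_inscriptionMap (θ := θ) φ₂ s2
  have hpull := HypProd.pullback_inscriptionMap_omegaA (φ₂ := φ₂) s1 s2 s3
  refine ⟨HypProd.expPair_bijective s2, hI, ha, HypProd.isSymplectic_omegaA ha,
    ⟨_, _, hb, hc, fun p => HypProd.twoForm_ext fun u w => ?_⟩, fun γ hγ =>
    ⟨HypProd.isLagrangianTorus_prod _ hγ, HypProd.isLagrangianTorus_image_prod hb hc hI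
      (HypProd.inscriptionMap_injective s2 s7) hpull hγ⟩⟩
  refine (hpull p u w).trans ?_
  exact congrArg₂ (fun s t => _ * s + _ * t) (HypProd.omega₁_apply p u w).symm
    (HypProd.omega₂_apply p u w).symm
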